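/- Let $p\ge 0$ and $d,k\ge 1$ be integers. Let $|\varphi_s^j\rangle$, for $1\le s\le p$ and $1\le j\le k$, be independent uniformly random unit vectors in $\mathbb{C}^d$. Put $|\varphi_s\rangle=|\varphi_s^1\rangle\otimes\cdots\otimes|\varphi_s^k\rangle$ and $M_{p,d,k}=\sum_{s=1}^p|\varphi_s\rangle\langle\varphi_s|$, and define the normalized moments $$e^m_{p,d,k}=\frac1{d^k}\,\mathbb{E}\big[\operatorname{tr}(M_{p,d,k}^m)\big]\qquad(m\ge 0).$$ For $m\ge1$ let $$\beta_m(t)=\sum_{\ell=1}^m N(m,\ell)\,t^\ell,\qquad N(m,\ell)=\frac1m\binom{m}{\ell-1}\binom{m}{\ell}$$ be the Narayana polynomial. For $m\ge 1$ set $$x=\frac p{d^k},\qquad \gamma=\frac{m^k}{d^{1/k}},\qquad \tilde x=\frac{p}{d^k}+\frac{3m^{k+3}}{d^{1/k}}.$$ **Lemma.** For all integers $m,d,k\ge1$ and $p\ge0$, $$e^m_{p,d,k}\le\Big(1+\frac{m^k}{d^{1/k}}\Big)\sum_{l=0}^{m-2}e^l_{p,d,k}\,e^{m-l-1}_{p,d,k}+\Big(\frac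 p{d^k}+\frac{3m^{k+3}}{d^{1/k}}\Big)e^{m-1}_{p,d,k},$$ and the right-hand side equals $$\Big(1+\frac{m^k}{d^{1/k}}\Big)\sum_{l=0}^{m-1}e^l_{p,d,k}\,e^{m-l-1}_{p,d,k}+\Big(\frac p{d^k}+\frac{3m^{k+3}}{d^{1/k}}-\Big(1+\frac{m^k}{d^{1/k}}\Big)\Big)e^{m-1}_{p,d,k}.$$ **Corollary.** For all integers $m,d,k\ge1$ and $p\ge0$, $$e^m_{p,d,k}\le(1+\gamma)^m\,\beta_m\!\Big(\frac{\tilde x}{1+\gamma}\Big).$$ If moreover $p\ge1$, then $$e^m_{p,d,k}\le\Big(\frac{\tilde x}{x}\Big)^m\beta_m(x)\le\exp\!\Big(\frac{3m^{k+4}}{x\,d^{1/k}}\Big)\beta_m(x),$$ so that in particular $$\frac1{d^k}\mathbb{E}\big[\operatorname{tr}(M_{p,d,k}^m)\big]\le\exp\!\Big(\frac{3m^{k+4}}{x\,d^{1/k}}\Big)\beta_m\!\Big(\frac p{d^k}\Big).$$ If in addition $x\le 3m^3$, then also $(1+\gamma)^m\beta_m\big(\tilde x/(1+\gamma)\big)\le(\tilde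 x/x)^m\beta_m(x)$. -/

import Mathlib

open MeasureTheory

noncomputable section

/-- The unit sphere of `ℂ^d` with its Hermitian norm. -/
abbrev UnitVec (d : ℕ) : Type :=
  Metric.sphere (0 : EuclideanSpace ℂ (Fin d)) 1

/-- The uniform probability measure on the unit sphere of `ℂ^d`: the surface measure, divided
by its total mass. -/
def uniformUnitVec (d : ℕ) : Measure (UnitVec d) :=
  ((volume : Measure (EuclideanSpace ℂ (Fin d))).toSphere Set.univ)⁻¹ •
    (volume : Measure (EuclideanSpace ℂ (Fin d))).toSphere

/-- The joint law of `p * k` independent uniformly random unit vectors `|φ_s^j⟩` of `ℂ^d`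
(`s` indexes the product states, `j` the tensor factors). -/
def productStateLaw (p d k : ℕ) : Measure (Fin p → Fin k → UnitVec d) :=
  Measure.pi fun _ => Measure.pi fun _ => uniformUnitVec d

/-- The vector `v 1 ⊗ ⋯ ⊗ v k` of `(ℂ^d)^{⊗k}`, in coordinates with respect to the product
basis, which is indexed by `Fin k → Fin d`. -/
def tensorVec {d k : ℕ} (v : Fin k → UnitVec d) : (Fin k → Fin d) → ℂ :=
  fun i => ∏ j, (v j : EuclideanSpace ℂ (Fin d)) (i j)

/-- The matrix `|v⟩⟨v|` of rank one. -/
def ketBra {ι : Type*} (v : ι → ℂ) : Matrix ι ι ℂ :=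
  Matrix.vecMulVec v (star v)

/-- The matrix `M = ∑ s, |φ_s⟩⟨φ_s|`, where `|φ_s⟩ = |φ_s^1⟩ ⊗ ⋯ ⊗ |φ_s^k⟩`. -/
def stateSum {p d k : ℕ} (v : Fin p → Fin k → UnitVec d) :
    Matrix (Fin k → Fin d) (Fin k → Fin d) ℂ :=
  ∑ s, ketBra (tensorVec (v s))

/-- The normalized moment `e^m_{p,d,k} = d^{-k} 𝔼[tr M^m]`. The trace is a real number, because
`M` is Hermitian. -/
def normMoment (p d k m : ℕ) : ℝ :=
  (1 / (d : ℝ) ^ k) * ∫ v, ((stateSum v ^ m).trace).re ∂(productStateLaw p d k)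

/-- The Narayana numbers, for `1 ≤ l ≤ m`. -/
def narayana (m l : ℕ) : ℝ :=
  (1 / (m : ℝ)) * (m.choose (l - 1) : ℝ) * (m.choose l : ℝ)

/-- The Narayana polynomial `β_m`, for `1 ≤ m`. -/
def narayanaPoly (m : ℕ) (x : ℝ) : ℝ :=
  ∑ l ∈ Finset.Icc 1 m, narayana m l * x ^ l

end

/-! Expanding the power gives `tr M^m` as a sum over words `w` of length `m` in `p` letters. The
tensor factors are independent with the same law, so the word `w` contributes `T(w)^k`, where `T(w)`
is the expected trace of the corresponding product of rank-one projections in a single factor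
(`normMoment_eq`).

Integration by parts on the sphere gives a Schwinger–Dyson equation (`polyMoment_wordTrace_cons`):
`(d + #c) T(cw)`, with `#c` the number of occurrences of `c` in `w`, is `T(w)` plus, for each
occurrence, the expectation of the product of the traces of the two words obtained by cutting there.
If these two words share no letter, the expectation factorizes; this can happen only at the last
occurrence of `c`. That one term receives weight `d` and every other term weight `1`, so the total
weight is at most `d + #c`, and Jensen's inequality bounds `T(cw)^k`
(`polyMoment_wordTrace_cons_pow_le`).

Summed over all words, the factorized terms give the convolution of lower moments, and the words
with a fresh first letter give `p / d^k`. A non-factorized product of traces merges back into the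
trace of one word, so all remaining terms cost at most `(n + 1)^3 / d` times the previous moment.
The recursion obtained (`normMoment_succ_le`) is stronger than the stated one: it has no factor `1 +
γ`, and its error is of order `1 / d` instead of `1 / d^(1/k)`.

Without error, this is the recursion of the Narayana polynomials (`convSeq_eq_narayanaPoly`), so
induction bounds the moments by `β_m` at a shifted argument. The stated bounds follow because `a^m
β_m(y / a)` increases with `a`, and from `1 + t ≤ exp t`. -/

/-! ### The convolution recursion of the Narayana polynomials -/

/-- The reciprocal of the factorial, extended by zero to the negative integers. -/
noncomputable def invFactorial (n : ℤ) : ℝ := if 0 ≤ n then ((n.toNat.factorial : ℕ) : ℝ)⁻¹ else 0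

lemma invFactorial_natCast (n : ℕ) : invFactorial n = ((n.factorial : ℕ) : ℝ)⁻¹ := by
  simp [invFactorial]

lemma invFactorial_of_neg {n : ℤ} (h : n < 0) : invFactorial n = 0 := by
  simp [invFactorial, h]

/-- Because this holds at every integer, including `n ≤ 0`, identities between Narayana numbers
reduce to polynomial identities without boundary cases. -/
lemma invFactorial_sub_one (n : ℤ) : invFactorial (n - 1) = n * invFactorial n := by
  rcases lt_trichotomy n 0 with h | h | h
  · rw [invFactorial_of_neg h, invFactorial_of_neg (by lia), mul_zero]
  · subst h; simp [invFactorial]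
  · obtain ⟨k, rfl⟩ : ∃ k : ℕ, n = k + 1 := ⟨(n - 1).toNat, by lia⟩
    rw [add_sub_cancel_right, invFactorial_natCast, ← Nat.cast_succ, invFactorial_natCast,
      Nat.factorial_succ]
    have : ((k.factorial : ℕ) : ℝ) ≠ 0 := by positivity
    have : (k : ℝ) + 1 ≠ 0 := by positivity
    push_cast
    field_simp

lemma choose_eq_invFactorial (m l : ℕ) :
    (m.choose l : ℝ) = m.factorial * invFactorial l * invFactorial (m - l) := by
  rcases le_or_gt l m with h | h
  · rw [← Nat.cast_sub h, invFactorial_natCast, invFactorial_natCast, Nat.cast_choose ℝ h]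
    field_simp
  · rw [Nat.choose_eq_zero_of_lt h, invFactorial_of_neg (n := (m : ℤ) - l) (by lia)]
    simp

/-- The Narayana numbers `N(n + 1, l)`, extended by zero to all integers `l`. -/
noncomputable def narayanaInt (n : ℕ) (l : ℤ) : ℝ :=
  n.factorial * (n + 1).factorial * invFactorial (l - 1) * invFactorial l *
    invFactorial (n + 1 - l) * invFactorial (n + 2 - l)

lemma narayanaInt_of_nonpos (n : ℕ) {l : ℤ} (h : l ≤ 0) : narayanaInt n l = 0 := by
  simp [narayanaInt, invFactorial_of_neg (n := l - 1) (by lia)]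

lemma narayanaInt_of_lt (n : ℕ) {l : ℤ} (h : (n : ℤ) + 1 < l) : narayanaInt n l = 0 := by
  simp [narayanaInt, invFactorial_of_neg (n := (n : ℤ) + 1 - l) (by lia)]

lemma narayana_succ (n l : ℕ) (hl : 1 ≤ l) : narayana (n + 1) l = narayanaInt n l := by
  rw [narayana, narayanaInt, choose_eq_invFactorial, choose_eq_invFactorial, Nat.cast_sub hl,
    Nat.factorial_succ]
  have h : ((n + 1 : ℕ) : ℤ) - ((l : ℤ) - (1 : ℕ)) = n + 2 - l := by push_cast; ring
  rw [h]
  have : (n : ℝ) + 1 ≠ 0 := by positivity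
  push_cast
  field_simp

lemma narayana_nonneg (m l : ℕ) : 0 ≤ narayana m l := by
  unfold narayana; positivity

/-- The free upper limit `M` lets polynomials of different degrees be compared coefficientwise over
one common range. -/
lemma narayanaPoly_succ (n M : ℕ) (h : n + 2 ≤ M) (x : ℝ) :
    narayanaPoly (n + 1) x = ∑ l ∈ Finset.range M, narayanaInt n l * x ^ l := by
  rw [narayanaPoly]
  have h1 : ∀ l ∈ Finset.Icc 1 (n + 1), narayana (n + 1) l * x ^ l = narayanaInt n l * x ^ l :=
    fun l hl => by rw [narayana_succ _ _ (Finset.mem_Icc.1 hl).1]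
  rw [Finset.sum_congr rfl h1]
  refine Finset.sum_subset (fun l hl => ?_) (fun l _ hl => ?_)
  · simp only [Finset.mem_Icc, Finset.mem_range] at *; lia
  · simp only [Finset.mem_Icc, not_and_or, not_le] at hl
    rcases hl with hl | hl
    · rw [narayanaInt_of_nonpos _ (by lia), zero_mul]
    · rw [narayanaInt_of_lt _ (by lia), zero_mul]

lemma mul_narayanaPoly_succ (n M : ℕ) (h : n + 2 ≤ M) (x : ℝ) :
    x * narayanaPoly (n + 1) x =
      ∑ l ∈ Finset.range (M + 1), narayanaInt n ((l : ℤ) - 1) * x ^ l := by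
  rw [narayanaPoly_succ n M h, Finset.sum_range_succ', Finset.mul_sum]
  rw [narayanaInt_of_nonpos n (l := ((0 : ℕ) : ℤ) - 1) (by simp), zero_mul, add_zero]
  refine Finset.sum_congr rfl fun l _ => ?_
  push_cast
  rw [add_sub_cancel_right]; ring

lemma sq_mul_narayanaPoly_succ (n M : ℕ) (h : n + 2 ≤ M) (x : ℝ) :
    x ^ 2 * narayanaPoly (n + 1) x =
      ∑ l ∈ Finset.range (M + 2), narayanaInt n ((l : ℤ) - 2) * x ^ l := by
  rw [pow_two, mul_assoc, mul_narayanaPoly_succ n M h, Finset.sum_range_succ' _ (M + 1),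
    Finset.mul_sum]
  rw [narayanaInt_of_nonpos n (l := ((0 : ℕ) : ℤ) - 2) (by simp), zero_mul, add_zero]
  refine Finset.sum_congr rfl fun l _ => ?_
  rw [show ((l + 1 : ℕ) : ℤ) - 2 = l - 1 by push_cast; ring]; ring

/-- All inverse factorials are multiples of `invFactorial l` and `invFactorial (n + 4 - l)`; in
these terms the claim is a polynomial identity. -/
lemma narayanaInt_three_term (n : ℕ) (l : ℤ) :
    ((n : ℝ) + 4) * narayanaInt (n + 2) l =
      (2 * n + 5) * (narayanaInt (n + 1) l + narayanaInt (n + 1) (l - 1)) -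
        (n + 1) * (narayanaInt n l - 2 * narayanaInt n (l - 1) + narayanaInt n (l - 2)) := by
  unfold narayanaInt
  push_cast [Nat.factorial_succ]
  have a1 := invFactorial_sub_one l
  have a2 : invFactorial (l - 2) = (l - 1) * (l * invFactorial l) := by
    rw [show l - 2 = (l - 1) - 1 by ring, invFactorial_sub_one, a1]; push_cast; ring
  have a3 : invFactorial (l - 3) = (l - 2) * ((l - 1) * (l * invFactorial l)) := by
    rw [show l - 3 = (l - 2) - 1 by ring, invFactorial_sub_one, a2]; push_cast; ring
  have b1 : invFactorial (n + 3 - l) = (n + 4 - l) * invFactorial (n + 4 - l) := by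
    rw [show (n + 3 - l : ℤ) = (n + 4 - l) - 1 by ring, invFactorial_sub_one]; push_cast; ring
  have b2 : invFactorial (n + 2 - l) =
      (n + 3 - l) * ((n + 4 - l) * invFactorial (n + 4 - l)) := by
    rw [show (n + 2 - l : ℤ) = (n + 3 - l) - 1 by ring, invFactorial_sub_one, b1]; push_cast; ring
  have b3 : invFactorial (n + 1 - l) =
      (n + 2 - l) * ((n + 3 - l) * ((n + 4 - l) * invFactorial (n + 4 - l))) := by
    rw [show (n + 1 - l : ℤ) = (n + 2 - l) - 1 by ring, invFactorial_sub_one, b2]; push_cast; ring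
  simp only [show l - 1 - 1 = l - 2 by ring, show l - 2 - 1 = l - 3 by ring,
    show (n : ℤ) + 2 + 1 - l = n + 3 - l by ring, show (n : ℤ) + 2 + 2 - l = n + 4 - l by ring,
    show (n : ℤ) + 1 + 1 - l = n + 2 - l by ring, show (n : ℤ) + 1 + 2 - l = n + 3 - l by ring,
    show (n : ℤ) + 1 + 1 - (l - 1) = n + 3 - l by ring,
    show (n : ℤ) + 1 + 2 - (l - 1) = n + 4 - l by ring,
    show (n : ℤ) + 1 - (l - 1) = n + 2 - l by ring,
    show (n : ℤ) + 2 - (l - 1) = n + 3 - l by ring,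
    show (n : ℤ) + 1 - (l - 2) = n + 3 - l by ring,
    show (n : ℤ) + 2 - (l - 2) = n + 4 - l by ring, a1, a2, a3, b1, b2, b3]
  ring

lemma narayanaPoly_three_term (n : ℕ) (x : ℝ) :
    ((n : ℝ) + 4) * narayanaPoly (n + 3) x =
      (x + 1) * (2 * n + 5) * narayanaPoly (n + 2) x -
        (x - 1) ^ 2 * (n + 1) * narayanaPoly (n + 1) x := by
  have e1 := narayanaPoly_succ (n + 2) (n + 4) (by lia) x
  have e2 := narayanaPoly_succ (n + 1) (n + 4) (by lia) x
  have e3 := mul_narayanaPoly_succ (n + 1) (n + 3) (by lia) x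
  have e4 := narayanaPoly_succ n (n + 4) (by lia) x
  have e5 := mul_narayanaPoly_succ n (n + 3) (by lia) x
  have e6 := sq_mul_narayanaPoly_succ n (n + 2) (by lia) x
  have key : ((n : ℝ) + 4) * narayanaPoly (n + 3) x =
      (2 * n + 5) * (narayanaPoly (n + 2) x + x * narayanaPoly (n + 2) x) -
        (n + 1) * (narayanaPoly (n + 1) x - 2 * (x * narayanaPoly (n + 1) x)
          + x ^ 2 * narayanaPoly (n + 1) x) := by
    rw [e6, e5, e4, e3, e2, e1]
    simp only [Finset.mul_sum, ← Finset.sum_add_distrib, ← Finset.sum_sub_distrib]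
    refine Finset.sum_congr rfl fun l _ => ?_
    linear_combination x ^ l * narayanaInt_three_term n l
  linear_combination key

/-- The sequence with `c 0 = 1` and `c (n + 1) = ∑ c l * c (n - l) + (x - 1) * c n`. -/
noncomputable def convSeq (x : ℝ) : ℕ → ℝ
  | 0 => 1
  | n + 1 => ∑ i : Fin (n + 1), convSeq x i * convSeq x (n - i) + (x - 1) * convSeq x n

lemma convSeq_zero (x : ℝ) : convSeq x 0 = 1 := by rw [convSeq]

lemma convSeq_succ (x : ℝ) (n : ℕ) : convSeq x (n + 1) =
    ∑ l ∈ Finset.range (n + 1), convSeq x l * convSeq x (n - l) + (x - 1) * convSeq x n := by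
  rw [convSeq, Finset.sum_range]

-- The generating function satisfies a quadratic equation, hence a first-order linear differential
-- equation with polynomial coefficients; its coefficients give a recurrence free of convolutions.
open PowerSeries in
lemma convSeq_three_term (x : ℝ) (n : ℕ) :
    ((n : ℝ) + 3) * convSeq x (n + 2) =
      (x + 1) * (2 * n + 3) * convSeq x (n + 1) - (x - 1) ^ 2 * n * convSeq x n := by
  set F : PowerSeries ℝ := PowerSeries.mk (convSeq x) with hFdef
  have hF : F = 1 + X * (F * F) + C (x - 1) * (X * F) := by
    ext k
    rcases k with _ | k
    · simp [hFdef, convSeq_zero]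
    · rw [map_add, map_add, coeff_succ_X_mul, coeff_C_mul, coeff_succ_X_mul, coeff_mul, coeff_one]
      simp only [hFdef, coeff_mk, Nat.add_eq_zero_iff, one_ne_zero, and_false, if_false, zero_add]
      rw [convSeq_succ, Finset.Nat.sum_antidiagonal_eq_sum_range_succ
        (fun i j => convSeq x i * convSeq x j)]
  have hD : d⁄dX ℝ F = F * F + X * (2 * F * d⁄dX ℝ F) + C (x - 1) * (F + X * d⁄dX ℝ F) := by
    conv_lhs => rw [hF]
    simp only [map_add, Derivation.leibniz, derivative_X, derivative_C, Derivation.map_one_eq_zero,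
      smul_eq_mul]
    ring
  have hx : C (x + 1) = C (x - 1) + (2 : PowerSeries ℝ) := by
    rw [← map_ofNat (C (R := ℝ)) 2, ← map_add]; congr 1; ring
  have key : X * d⁄dX ℝ F + C ((x - 1) ^ 2) * (X * (X * (X * d⁄dX ℝ F)))
      + F = C (2 * (x + 1)) * (X * (X * d⁄dX ℝ F)) + 1 + C (x - 1) * X + C (x + 1) * (X * F) := by
    rw [map_mul, map_pow, hx, map_ofNat]
    set a := C (x - 1)
    set G := d⁄dX ℝ F
    -- The factor `1 - aX - 2XF` is, up to sign, the derivative of the quadratic in `F`; its square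
    -- equals the discriminant `(1 - aX)^2 - 4X`, which is free of `F`.
    linear_combination (X * (1 - a * X - 2 * X * F)) * hD +
      (2 + 4 * X ^ 2 * G - (1 - a * X - 2 * X * F)) * hF
  have hX : ∀ j, coeff j (X * d⁄dX ℝ F) = j * convSeq x j := by
    intro j
    rcases j with _ | j
    · simp
    · rw [coeff_succ_X_mul, coeff_derivative, hFdef, coeff_mk]; push_cast; ring
  obtain ⟨y, hy⟩ : ∃ y, y = x + 1 := ⟨_, rfl⟩
  rw [← hy] at key ⊢
  have h2 := congrArg (coeff (n + 2)) key
  simp only [map_add, coeff_C_mul, coeff_succ_X_mul, hX] at h2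
  have hFc : ∀ j, coeff j F = convSeq x j := fun j => by rw [hFdef, coeff_mk]
  simp only [hFc, coeff_one, coeff_X, Nat.add_eq_zero_iff, OfNat.ofNat_ne_zero, and_false, if_false,
    show n + 2 ≠ 1 by lia] at h2
  push_cast at h2
  linear_combination h2

lemma narayanaPoly_one (x : ℝ) : narayanaPoly 1 x = x := by
  simp [narayanaPoly, narayana]

lemma narayanaPoly_two (x : ℝ) : narayanaPoly 2 x = x + x ^ 2 := by
  simp [narayanaPoly, narayana, Finset.sum_Icc_succ_top]

/-- Both sides obey the same three-term recurrence, with the same two initial values. -/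
lemma convSeq_eq_narayanaPoly (x : ℝ) : ∀ n, convSeq x (n + 1) = narayanaPoly (n + 1) x
  | 0 => by simp [convSeq_succ, convSeq_zero, narayanaPoly_one]
  | 1 => by
      simp [convSeq_succ, convSeq_zero, narayanaPoly_two, Finset.sum_range_succ]; ring
  | n + 2 => by
      have h1 := narayanaPoly_three_term n x
      have h2 := convSeq_three_term x (n + 1)
      rw [show n + 1 + 2 = n + 2 + 1 by ring, convSeq_eq_narayanaPoly x (n + 1),
        convSeq_eq_narayanaPoly x n] at h2
      have h : ((n : ℝ) + 4) ≠ 0 := by positivity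
      refine mul_left_cancel₀ h ?_
      push_cast at h2
      linear_combination h2 - h1

lemma convSeq_succ' (x : ℝ) (n : ℕ) : convSeq x (n + 1) =
    ∑ l ∈ Finset.range n, convSeq x l * convSeq x (n - l) + x * convSeq x n := by
  rw [convSeq_succ, Finset.sum_range_succ, Nat.sub_self, convSeq_zero]; ring

/-! ### Moments of the uniform distribution on the unit sphere of `ℂ^d` -/

open ComplexConjugate in
lemma integral_pow_mul_conj_pow_mul_exp (a b : ℕ) :
    ∫ z : ℂ, z ^ a * conj z ^ b * (Real.exp (-‖z‖ ^ 2) : ℂ) =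
      if a = b then (Real.pi * a.factorial : ℂ) else 0 := by
  split_ifs with hab
  · subst hab
    have h := Complex.integral_rpow_mul_exp_neg_rpow (p := 2) (q := 2 * a) (by norm_num)
      (by have : (0 : ℝ) ≤ a := a.cast_nonneg
          linarith)
    have h2 : (2 * (a : ℝ) + 2) / 2 = a + 1 := by ring
    rw [h2, Real.Gamma_nat_eq_factorial] at h
    have h3 : ∀ z : ℂ, z ^ a * conj z ^ a * (Real.exp (-‖z‖ ^ 2) : ℂ) =
        ((‖z‖ ^ (2 * (a : ℝ)) * Real.exp (-‖z‖ ^ (2 : ℝ)) : ℝ) : ℂ) := by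
      intro z
      rw [← mul_pow, Complex.mul_conj, Complex.normSq_eq_norm_sq, ← Complex.ofReal_pow,
        ← pow_mul, ← Complex.ofReal_mul]
      congr 2
      · rw [← Real.rpow_natCast]; push_cast; rfl
      · congr 1; norm_cast
    simp_rw [h3]
    rw [integral_complex_ofReal, h]
    push_cast; ring
  · have hne : (a : ℂ) - b ≠ 0 := by
      rw [sub_ne_zero]; exact_mod_cast hab
    -- Rotation by the angle `π / (a - b)` preserves the measure and multiplies the integrand by
    -- `-1`, so the integral vanishes.
    let u : Circle := Circle.exp (Real.pi / ((a : ℝ) - b))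
    have hu : (u : ℂ) ^ a * conj (u : ℂ) ^ b = -1 := by
      rw [← Circle.coe_inv_eq_conj, show u = Circle.exp (Real.pi / ((a : ℝ) - b)) from rfl,
        ← Circle.exp_neg, Circle.coe_exp, Circle.coe_exp, ← Complex.exp_nat_mul,
        ← Complex.exp_nat_mul, ← Complex.exp_add, ← Complex.exp_pi_mul_I]
      congr 1
      push_cast
      field_simp
      ring
    have h := ((rotation u).measurePreserving).integral_comp
      (rotation u).toHomeomorph.measurableEmbedding
      (fun z : ℂ => z ^ a * conj z ^ b * (Real.exp (-‖z‖ ^ 2) : ℂ))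
    have h2 : ∀ z : ℂ, (rotation u z) ^ a * conj (rotation u z) ^ b *
        (Real.exp (-‖rotation u z‖ ^ 2) : ℂ) =
        -(z ^ a * conj z ^ b * (Real.exp (-‖z‖ ^ 2) : ℂ)) := by
      intro z
      rw [LinearIsometryEquiv.norm_map, rotation_apply, map_mul, mul_pow, mul_pow]
      linear_combination (z ^ a * conj z ^ b * (Real.exp (-‖z‖ ^ 2) : ℂ)) * hu
    simp_rw [h2] at h
    rw [integral_neg] at h
    exact self_eq_neg.mp h.symm

lemma integral_Ioi_pow_mul_exp_neg_sq (n : ℕ) :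
    ∫ r in Set.Ioi (0 : ℝ), r ^ n * Real.exp (-r ^ 2) = Real.Gamma (((n : ℝ) + 1) / 2) / 2 := by
  have h := integral_rpow_mul_exp_neg_rpow (p := 2) (q := n) (by norm_num)
    (by have : (0 : ℝ) ≤ n := n.cast_nonneg
        linarith)
  norm_cast at h ⊢
  rw [h]; push_cast; ring

/-- Integration in polar coordinates of a homogeneous function against a Gaussian. -/
lemma integral_homogeneous_mul_exp {E : Type*} [NormedAddCommGroup E] [NormedSpace ℝ E]
    [MeasurableSpace E] [BorelSpace E] [FiniteDimensional ℝ E] [Nontrivial E] (μ : Measure E)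
    [μ.IsAddHaarMeasure] (h : E → ℂ) (n : ℕ)
    (hh : ∀ (r : ℝ) (x : E), 0 < r → h (r • x) = r ^ n * h x) :
    ∫ x, h x * (Real.exp (-‖x‖ ^ 2) : ℂ) ∂μ =
      (∫ u, h u ∂μ.toSphere) *
        ((Real.Gamma (((Module.finrank ℝ E + n : ℕ) : ℝ) / 2) / 2 : ℝ) : ℂ) := by
  let f : E → ℂ := fun x => h x * (Real.exp (-‖x‖ ^ 2) : ℂ)
  calc ∫ x, f x ∂μ = ∫ x : ({(0)}ᶜ : Set E), f x.1 ∂(μ.comap (↑)) := by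
        rw [integral_subtype_comap (measurableSet_singleton _).compl f,
          restrict_compl_singleton]
    _ = ∫ x, h x.1 * ((x.2 : ℝ) ^ n * (Real.exp (-(x.2 : ℝ) ^ 2) : ℂ))
          ∂μ.toSphere.prod (.volumeIoiPow (Module.finrank ℝ E - 1)) := by
        rw [← μ.measurePreserving_homeomorphUnitSphereProd.integral_comp
          (Homeomorph.measurableEmbedding _)]
        refine integral_congr_ae (.of_forall fun x => ?_)
        have hx : 0 < ‖(x : E)‖ := norm_pos_iff.2 x.2
        simp only [homeomorphUnitSphereProd_apply_snd_coe, homeomorphUnitSphereProd_apply_fst_coe, f]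
        have := hh ‖(x : E)‖ (‖(x : E)‖⁻¹ • (x : E)) hx
        rw [smul_inv_smul₀ hx.ne'] at this
        rw [this]; push_cast; ring
    _ = (∫ u, h u ∂μ.toSphere) * ∫ r : Set.Ioi (0 : ℝ),
          ((r : ℝ) ^ n * (Real.exp (-(r : ℝ) ^ 2) : ℂ)) ∂.volumeIoiPow (Module.finrank ℝ E - 1) :=
        integral_prod_mul (L := ℂ) (fun u : Metric.sphere (0 : E) 1 => h u)
          (fun r : Set.Ioi (0 : ℝ) => ((r : ℝ) ^ n * (Real.exp (-(r : ℝ) ^ 2) : ℂ)))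
    _ = _ := by
        congr 1
        have hE : 0 < Module.finrank ℝ E := Module.finrank_pos
        rw [show ((Module.finrank ℝ E + n : ℕ) : ℝ) = ((Module.finrank ℝ E - 1 + n : ℕ) : ℝ) + 1 by
          rw [← Nat.cast_succ]; congr 1; lia, ← integral_Ioi_pow_mul_exp_neg_sq,
          ← integral_complex_ofReal]
        simp only [Measure.volumeIoiPow, ENNReal.ofReal]
        rw [integral_withDensity_eq_integral_smul, integral_subtype_comap measurableSet_Ioi
          fun a : ℝ ↦ Real.toNNReal (a ^ (Module.finrank ℝ E - 1)) •
            ((a : ℂ) ^ n * (Real.exp (-a ^ 2) : ℂ)),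
          setIntegral_congr_fun measurableSet_Ioi fun x hx ↦ ?_]
        · rw [NNReal.smul_def, Real.coe_toNNReal _ (pow_nonneg (le_of_lt hx) _), pow_add]
          push_cast
          rw [Complex.real_smul]; push_cast; ring
        · exact (measurable_subtype_coe.pow_const _).real_toNNReal

/-- The moment `𝔼 ∏ x, φ_x ^ α_x * conj φ_x ^ β_x` of a uniformly random unit vector of `ℂ^d`. -/
noncomputable def sphereMoment {d : ℕ} (α β : Fin d → ℕ) : ℝ :=
  if α = β then (∏ x, ((α x).factorial : ℝ)) * (d - 1).factorial / (∑ x, α x + d - 1).factorial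
  else 0

lemma sphereMoment_nonneg {d : ℕ} (α β : Fin d → ℕ) : 0 ≤ sphereMoment α β := by
  unfold sphereMoment; split_ifs <;> positivity

-- The Gaussian weight factorizes over the coordinates. The constant `c` absorbs the normalization
-- of the volume and need not be computed, since it cancels once the sphere has total mass one.
open ComplexConjugate in
lemma exists_integral_gaussian_eq (d : ℕ) : ∃ c : ℂ, c ≠ 0 ∧ ∀ α β : Fin d → ℕ,
    ∫ v : EuclideanSpace ℂ (Fin d), (∏ x, v x ^ α x * conj (v x : ℂ) ^ β x) *
      (Real.exp (-‖v‖ ^ 2) : ℂ) =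
    c * ∏ x, if α x = β x then ((α x).factorial : ℂ) else 0 := by
  let e : EuclideanSpace ℂ (Fin d) ≃L[ℝ] (Fin d → ℂ) := PiLp.continuousLinearEquiv 2 ℝ _
  have := e.isAddHaarMeasure_map volume
  have h0 := Measure.isAddLeftInvariant_eq_smul (Measure.map e volume)
    (volume : Measure (Fin d → ℂ))
  set c := Measure.addHaarScalarFactor (Measure.map e volume) (volume : Measure (Fin d → ℂ))
  have hc : c ≠ 0 := (Measure.addHaarScalarFactor_pos_of_isAddHaarMeasure _ _).ne'
  refine ⟨(c : ℂ) * Real.pi ^ d, mul_ne_zero (by exact_mod_cast hc)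
    (pow_ne_zero _ (by exact_mod_cast Real.pi_ne_zero)), fun α β => ?_⟩
  have h1 : ∀ v : EuclideanSpace ℂ (Fin d), (∏ x, v x ^ α x * conj (v x : ℂ) ^ β x) *
      (Real.exp (-‖v‖ ^ 2) : ℂ) =
      ∏ x, (e v x ^ α x * conj (e v x) ^ β x * (Real.exp (-‖e v x‖ ^ 2) : ℂ)) := by
    intro v
    rw [Finset.prod_mul_distrib (g := fun x => (Real.exp (-‖e v x‖ ^ 2) : ℂ)),
      ← Complex.ofReal_prod, ← Real.exp_sum, EuclideanSpace.norm_sq_eq, Finset.sum_neg_distrib]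
    rfl
  simp_rw [h1]
  have h3 := e.toHomeomorph.measurableEmbedding.integral_map (μ := volume)
    (fun v : Fin d → ℂ => ∏ x, (v x ^ α x * conj (v x) ^ β x * (Real.exp (-‖v x‖ ^ 2) : ℂ)))
  refine h3.symm.trans ?_
  change ∫ v : Fin d → ℂ, _ ∂(Measure.map e volume) = _
  rw [h0, integral_smul_nnreal_measure, integral_fintype_prod_volume_eq_prod
    (fun x (z : ℂ) => z ^ α x * conj z ^ β x * (Real.exp (-‖z‖ ^ 2) : ℂ))]
  simp_rw [integral_pow_mul_conj_pow_mul_exp]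
  have h2 : ∀ x, (if α x = β x then (Real.pi * (α x).factorial : ℂ) else 0) =
      Real.pi * if α x = β x then ((α x).factorial : ℂ) else 0 := fun x => by
    split_ifs <;> simp
  simp_rw [h2]
  rw [Finset.prod_mul_distrib, Finset.prod_const, Finset.card_univ, Fintype.card_fin,
    NNReal.smul_def, Complex.real_smul]
  ring

lemma finrank_real_euclideanSpace_complex (d : ℕ) :
    Module.finrank ℝ (EuclideanSpace ℂ (Fin d)) = 2 * d := by
  rw [← Module.finrank_mul_finrank ℝ ℂ]
  simp [Complex.finrank_real_complex]

-- The Gaussian integral of a homogeneous function is its spherical integral times a known radial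
-- factor, so dividing by the latter gives the spherical moments up to a common constant.
open ComplexConjugate in
lemma integral_toSphere_monomial {d : ℕ} (hd : 1 ≤ d) : ∃ c : ℂ, c ≠ 0 ∧ ∀ α β : Fin d → ℕ,
    ∫ v : UnitVec d, (∏ x, v.1 x ^ α x * conj (v.1 x : ℂ) ^ β x)
      ∂(volume : Measure (EuclideanSpace ℂ (Fin d))).toSphere = c * sphereMoment α β := by
  obtain ⟨c, hc, h⟩ := exists_integral_gaussian_eq d
  have : Nonempty (Fin d) := ⟨⟨0, hd⟩⟩
  have hdf : ((d - 1).factorial : ℂ) ≠ 0 := by exact_mod_cast (d - 1).factorial_ne_zero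
  refine ⟨2 * c / (d - 1).factorial, div_ne_zero (mul_ne_zero two_ne_zero hc) hdf,
    fun α β => ?_⟩
  have h1 := integral_homogeneous_mul_exp (volume : Measure (EuclideanSpace ℂ (Fin d)))
    (fun v => ∏ x, v x ^ α x * conj (v x : ℂ) ^ β x) (∑ x, (α x + β x)) (fun r v hr => by
      simp only [PiLp.smul_apply, Complex.real_smul, map_mul, mul_pow, Complex.conj_ofReal]
      rw [← Finset.prod_pow_eq_pow_sum, ← Finset.prod_mul_distrib]
      refine Finset.prod_congr rfl fun x _ => ?_
      ring)
  rw [h, finrank_real_euclideanSpace_complex] at h1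
  set I := ∫ v : UnitVec d, (∏ x, v.1 x ^ α x * conj (v.1 x : ℂ) ^ β x)
      ∂(volume : Measure (EuclideanSpace ℂ (Fin d))).toSphere
  have hpos : 0 < Real.Gamma (((2 * d + ∑ x, (α x + β x) : ℕ) : ℝ) / 2) :=
    Real.Gamma_pos_of_pos (by positivity)
  unfold sphereMoment
  split_ifs with hab
  · subst hab
    have h2 : (((2 * d + ∑ x, (α x + α x) : ℕ) : ℝ) / 2) = ((∑ x, α x + d - 1 : ℕ) : ℝ) + 1 := by
      rw [← Nat.cast_succ, Nat.succ_eq_add_one, Nat.sub_add_cancel (by lia),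
        Finset.sum_add_distrib]
      push_cast; ring
    rw [h2, Real.Gamma_nat_eq_factorial] at h1
    have h3 : (((∑ x, α x + d - 1).factorial : ℕ) : ℂ) ≠ 0 := by
      exact_mod_cast Nat.factorial_ne_zero _
    simp only [if_true] at h1
    push_cast at h1 ⊢
    field_simp
    linear_combination (-2) * h1
  · obtain ⟨x, hx⟩ := Function.ne_iff.1 hab
    rw [Finset.prod_eq_zero (Finset.mem_univ x) (if_neg hx), mul_zero] at h1
    have h3 : I = 0 := (mul_eq_zero.1 h1.symm).resolve_right (by
      exact_mod_cast (half_pos hpos).ne')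
    rw [h3]; simp

open ComplexConjugate in
/-- The moments of a uniformly random unit vector. -/
lemma integral_uniformUnitVec_monomial {d : ℕ} (hd : 1 ≤ d) (α β : Fin d → ℕ) :
    ∫ v : UnitVec d, (∏ x, v.1 x ^ α x * conj (v.1 x : ℂ) ^ β x) ∂uniformUnitVec d =
      sphereMoment α β := by
  obtain ⟨c, hc, h⟩ := integral_toSphere_monomial hd
  -- The constant monomial identifies `c` with the total mass of the sphere.
  have h0 := h 0 0
  have h1 : sphereMoment (0 : Fin d → ℕ) 0 = 1 := by
    have := (d - 1).factorial_ne_zero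
    simp [sphereMoment, this]
  simp only [Pi.zero_apply, pow_zero, mul_one, Finset.prod_const_one, integral_const, h1] at h0
  rw [uniformUnitVec, integral_smul_measure, h, ENNReal.toReal_inv]
  rw [Complex.real_smul, mul_one, Complex.ofReal_one, mul_one] at h0
  rw [Complex.real_smul, Complex.ofReal_inv, ← h0]
  rw [← h0] at hc
  simp only [Measure.real] at hc ⊢
  field_simp

lemma isProbabilityMeasure_uniformUnitVec {d : ℕ} (hd : 1 ≤ d) :
    IsProbabilityMeasure (uniformUnitVec d) := by
  have : Nonempty (Fin d) := ⟨⟨0, hd⟩⟩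
  constructor
  rw [uniformUnitVec, Measure.smul_apply, smul_eq_mul]
  refine ENNReal.inv_mul_cancel ?_ (measure_ne_top _ _)
  rw [Measure.measure_univ_ne_zero]
  exact Measure.toSphere_ne_zero _

/-! ### Moments of polynomials in independent random unit vectors -/

/-- The variables of a polynomial in the coordinates of vectors `v c` of `ℂ^d` and in their complex
conjugates: `(c, x, false)` stands for `v c x` and `(c, x, true)` for its conjugate. -/
abbrev CoordVar (A : Type*) (d : ℕ) : Type _ := A × Fin d × Bool

/-- The expectation of a monomial in the coordinates of independent random unit vectors. -/
noncomputable def monomialMoment {A : Type*} [Fintype A] {d : ℕ} (α : CoordVar A d →₀ ℕ) : ℝ :=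
  ∏ c, sphereMoment (fun x => α (c, x, false)) (fun x => α (c, x, true))

/-- The expectation of a polynomial in the coordinates of independent random unit vectors. -/
noncomputable def polyMoment {A : Type*} [Fintype A] {d : ℕ} :
    MvPolynomial (CoordVar A d) ℕ →ₗ[ℕ] ℝ :=
  (MvPolynomial.basisMonomials _ ℕ).constr ℕ monomialMoment

/-- The values of the coordinate variables at given unit vectors. -/
noncomputable def coordValue {A : Type*} {d : ℕ} (v : A → UnitVec d) : CoordVar A d → ℂ :=
  fun i => if i.2.2 then (starRingEnd ℂ) ((v i.1).1 i.2.1) else (v i.1).1 i.2.1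

section

variable {A : Type*} [Fintype A] {d : ℕ}

lemma monomialMoment_nonneg (α : CoordVar A d →₀ ℕ) : 0 ≤ monomialMoment α :=
  Finset.prod_nonneg fun _ _ => sphereMoment_nonneg _ _

lemma polyMoment_monomial (α : CoordVar A d →₀ ℕ) (n : ℕ) :
    polyMoment (MvPolynomial.monomial α n) = n * monomialMoment α := by
  have h : MvPolynomial.monomial α n = n • MvPolynomial.basisMonomials (CoordVar A d) ℕ α := by
    rw [MvPolynomial.coe_basisMonomials, MvPolynomial.smul_monomial, smul_eq_mul, mul_one]
  rw [h, map_smul, polyMoment, Module.Basis.constr_basis, nsmul_eq_mul]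

lemma polyMoment_eq_sum (Q : MvPolynomial (CoordVar A d) ℕ) :
    polyMoment Q = ∑ α ∈ Q.support, ((Q.coeff α : ℕ) : ℝ) * monomialMoment α := by
  conv_lhs => rw [Q.as_sum]
  rw [map_sum]
  exact Finset.sum_congr rfl fun α _ => polyMoment_monomial _ _

/-- This is the reason for coefficients in `ℕ`: every monomial has nonnegative moment, so no
cancellation can occur. -/
lemma polyMoment_nonneg (Q : MvPolynomial (CoordVar A d) ℕ) : 0 ≤ polyMoment Q := by
  rw [polyMoment_eq_sum]
  exact Finset.sum_nonneg fun α _ => mul_nonneg (Nat.cast_nonneg _) (monomialMoment_nonneg α)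

lemma sphereMoment_zero : sphereMoment (fun _ : Fin d => 0) (fun _ => 0) = 1 := by
  have := (d - 1).factorial_ne_zero
  simp [sphereMoment, this]

lemma polyMoment_one : polyMoment (1 : MvPolynomial (CoordVar A d) ℕ) = 1 := by
  have h : (1 : MvPolynomial (CoordVar A d) ℕ) = MvPolynomial.monomial 0 1 := rfl
  rw [h, polyMoment_monomial]
  simp [monomialMoment, sphereMoment_zero]

/-- Polynomials in the coordinates of disjoint sets of vectors are uncorrelated. -/
lemma polyMoment_mul_of_disjoint (P Q : MvPolynomial (CoordVar A d) ℕ)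
    (h : ∀ i ∈ P.vars, ∀ j ∈ Q.vars, i.1 ≠ j.1) :
    polyMoment (P * Q) = polyMoment P * polyMoment Q := by
  have h1 : P * Q = ∑ α ∈ P.support, ∑ β ∈ Q.support,
      MvPolynomial.monomial (α + β) (P.coeff α * Q.coeff β) := by
    conv_lhs => rw [P.as_sum, Q.as_sum]
    rw [Finset.sum_mul_sum]
    simp only [MvPolynomial.monomial_mul]
  rw [h1, polyMoment_eq_sum P, polyMoment_eq_sum Q, Finset.sum_mul_sum, map_sum]
  refine Finset.sum_congr rfl fun α hα => ?_
  rw [map_sum]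
  refine Finset.sum_congr rfl fun β hβ => ?_
  rw [polyMoment_monomial]
  have h2 : monomialMoment (α + β) = monomialMoment α * monomialMoment β := by
    unfold monomialMoment
    rw [← Finset.prod_mul_distrib]
    refine Finset.prod_congr rfl fun c _ => ?_
    -- Each vector `c` occurs in at most one of the two monomials, so one of the two factors at `c`
    -- is `1`.
    by_cases hc : ∃ x b, α (c, x, b) ≠ 0
    · obtain ⟨x, b, hx⟩ := hc
      have h3 : ∀ y b', β (c, y, b') = 0 := by
        intro y b'
        by_contra hy
        exact h (c, x, b) (MvPolynomial.mem_vars_iff_mem_support _ |>.2 ⟨α, hα, Finsupp.mem_support_iff.2 hx⟩)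
          (c, y, b') (MvPolynomial.mem_vars_iff_mem_support _ |>.2 ⟨β, hβ, Finsupp.mem_support_iff.2 hy⟩) rfl
      simp [h3, sphereMoment_zero]
    · push Not at hc
      simp [hc, sphereMoment_zero]
  rw [h2]; push_cast; ring

lemma continuous_aeval_coordValue {B : Type*} (g : B → A → UnitVec d)
    [TopologicalSpace B] (hg : ∀ c, Continuous fun b => g b c)
    (Q : MvPolynomial (CoordVar A d) ℕ) :
    Continuous fun b => MvPolynomial.aeval (coordValue (g b)) Q := by
  have h : ∀ i, Continuous fun b => coordValue (g b) i := by
    intro i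
    have h1 : Continuous fun b => (g b i.1).1 i.2.1 := by
      have := continuous_subtype_val.comp (hg i.1)
      fun_prop
    unfold coordValue
    split_ifs
    · exact Complex.continuous_conj.comp h1
    · exact h1
  simp only [MvPolynomial.aeval_def, MvPolynomial.eval₂_eq']
  fun_prop

lemma aeval_coordValue_eq_sum (v : A → UnitVec d) (Q : MvPolynomial (CoordVar A d) ℕ) :
    MvPolynomial.aeval (coordValue v) Q = ∑ α ∈ Q.support, ((Q.coeff α : ℕ) : ℂ) *
      ∏ c, ∏ x, (v c).1 x ^ α (c, x, false) *
        (starRingEnd ℂ) ((v c).1 x) ^ α (c, x, true) := by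
  rw [MvPolynomial.aeval_def, MvPolynomial.eval₂_eq']
  refine Finset.sum_congr rfl fun α _ => ?_
  simp only [Fintype.prod_prod_type, Fintype.prod_bool, coordValue]
  simp [mul_comm]

end

lemma integrable_prod_aeval {p d k : ℕ} (hd : 1 ≤ d)
    (Q : Fin k → MvPolynomial (CoordVar (Fin p) d) ℕ) :
    Integrable (fun v : Fin p → Fin k → UnitVec d =>
      ∏ j, MvPolynomial.aeval (coordValue fun s => v s j) (Q j)) (productStateLaw p d k) := by
  have := isProbabilityMeasure_uniformUnitVec hd
  have : IsFiniteMeasure (productStateLaw p d k) := by unfold productStateLaw; infer_instance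
  refine Continuous.integrable_of_hasCompactSupport ?_ (.of_compactSpace _)
  refine continuous_finsetProd _ fun j _ => ?_
  refine continuous_aeval_coordValue (fun v : Fin p → Fin k → UnitVec d => fun s => v s j)
    (fun c => ?_) (Q j)
  fun_prop

/-- The `k` tensor factors are independent. -/
lemma integral_prod_aeval {p d k : ℕ} (hd : 1 ≤ d)
    (Q : Fin k → MvPolynomial (CoordVar (Fin p) d) ℕ) :
    ∫ v, ∏ j, MvPolynomial.aeval (coordValue fun s => v s j) (Q j) ∂(productStateLaw p d k) =
      ((∏ j, polyMoment (Q j) : ℝ) : ℂ) := by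
  have := isProbabilityMeasure_uniformUnitVec hd
  have : IsFiniteMeasure (productStateLaw p d k) := by unfold productStateLaw; infer_instance
  simp only [aeval_coordValue_eq_sum, polyMoment_eq_sum, Finset.prod_univ_sum]
  rw [integral_finsetSum]
  · push_cast
    refine Finset.sum_congr rfl fun α _ => ?_
    simp only [Finset.prod_mul_distrib (f := fun j => (((Q j).coeff (α j) : ℕ) : ℂ))]
    rw [integral_const_mul]
    congr 1
    simp only [Finset.prod_comm (s := (Finset.univ : Finset (Fin k)))
      (t := (Finset.univ : Finset (Fin p))), monomialMoment]
    rw [productStateLaw, integral_fintype_prod_eq_prod (fun s (u : Fin k → UnitVec d) =>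
      ∏ j, ∏ x, (u j).1 x ^ α j (s, x, false) * (starRingEnd ℂ) ((u j).1 x) ^ α j (s, x, true))]
    push_cast
    rw [Finset.prod_comm (s := (Finset.univ : Finset (Fin k)))]
    refine Finset.prod_congr rfl fun s _ => ?_
    rw [integral_fintype_prod_eq_prod (fun j (u : UnitVec d) =>
      ∏ x, u.1 x ^ α j (s, x, false) * (starRingEnd ℂ) (u.1 x) ^ α j (s, x, true))]
    exact Finset.prod_congr rfl fun j _ => integral_uniformUnitVec_monomial hd _ _
  · intro α _
    refine Continuous.integrable_of_hasCompactSupport ?_ (.of_compactSpace _)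
    refine continuous_finsetProd _ fun j _ => continuous_const.mul ?_
    refine continuous_finsetProd _ fun s _ => continuous_finsetProd _ fun x _ => ?_
    have h1 : Continuous fun v : Fin p → Fin k → UnitVec d => (v s j).1 x := by
      have : Continuous fun v : Fin p → Fin k → UnitVec d => (v s j).1 := by fun_prop
      fun_prop
    exact (h1.pow _).mul ((Complex.continuous_conj.comp h1).pow _)

/-! ### Traces of words in rank-one projections, as polynomials -/

section

open Matrix

variable {A : Type*} {d : ℕ}

/-- The matrix `|v c⟩⟨v c|`, with polynomial entries. -/
noncomputable def letterMatrix (d : ℕ) (c : A) :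
    Matrix (Fin d) (Fin d) (MvPolynomial (CoordVar A d) ℕ) :=
  vecMulVec (fun x => MvPolynomial.X (c, x, false)) (fun x => MvPolynomial.X (c, x, true))

/-- The product of the matrices `|v c⟩⟨v c|` over the letters `c` of a word. -/
noncomputable def wordMatrix (d : ℕ) (w : List A) :
    Matrix (Fin d) (Fin d) (MvPolynomial (CoordVar A d) ℕ) :=
  (w.map (letterMatrix d)).prod

/-- The trace of the product of the matrices `|v c⟩⟨v c|` over the letters `c` of a word. -/
noncomputable def wordTrace (d : ℕ) (w : List A) : MvPolynomial (CoordVar A d) ℕ :=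
  (wordMatrix d w).trace

lemma wordMatrix_nil : wordMatrix d ([] : List A) = 1 := rfl

lemma wordMatrix_cons (c : A) (w : List A) :
    wordMatrix d (c :: w) = letterMatrix d c * wordMatrix d w := by
  simp [wordMatrix]

lemma wordMatrix_append (a b : List A) :
    wordMatrix d (a ++ b) = wordMatrix d a * wordMatrix d b := by
  simp [wordMatrix]

lemma wordTrace_append_comm (a b : List A) : wordTrace d (a ++ b) = wordTrace d (b ++ a) := by
  rw [wordTrace, wordTrace, wordMatrix_append, wordMatrix_append, trace_mul_comm]

lemma wordTrace_rotate (a : List A) (n : ℕ) : wordTrace d (a.rotate n) = wordTrace d a := by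
  rw [List.rotate_eq_drop_append_take_mod, wordTrace_append_comm, List.take_append_drop]

lemma wordTrace_nil : wordTrace d ([] : List A) = d := by
  simp [wordTrace, wordMatrix_nil]

lemma wordTrace_cons (c : A) (w : List A) :
    wordTrace d (c :: w) = ∑ x, MvPolynomial.X (c, x, false) *
      ∑ y, MvPolynomial.X (c, y, true) * wordMatrix d w y x := by
  rw [wordTrace, wordMatrix_cons, letterMatrix, vecMulVec_mul, trace_vecMulVec]
  rfl

lemma wordTrace_cons_eq_dotProduct (c : A) (w : List A) :
    wordTrace d (c :: w) = (fun y => MvPolynomial.X (c, y, true)) ⬝ᵥ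
      (wordMatrix d w *ᵥ fun x => MvPolynomial.X (c, x, false)) := by
  rw [wordTrace, wordMatrix_cons, letterMatrix, vecMulVec_mul, trace_vecMulVec, dotProduct_comm,
    dotProduct_mulVec]

/-- For a matrix `P` of rank one, `P * B * P = tr (P * B) • P`. -/
lemma letterMatrix_mul_mul_letterMatrix (c : A) (w : List A) :
    letterMatrix d c * wordMatrix d w * letterMatrix d c =
      wordTrace d (c :: w) • letterMatrix d c := by
  rw [wordTrace_cons_eq_dotProduct, Matrix.mul_assoc, letterMatrix, mul_vecMulVec,
    vecMulVec_mul_vecMulVec]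
  ext1 x y
  simp only [vecMulVec_apply, Matrix.smul_apply, Pi.smul_apply, smul_eq_mul]
  ring

/-- Two loops through a common letter merge. -/
lemma wordTrace_cons_mul_wordTrace_cons (c : A) (a b : List A) :
    wordTrace d (c :: a) * wordTrace d (c :: b) = wordTrace d (c :: a ++ c :: b) := by
  conv_rhs => rw [wordTrace, wordMatrix_append, wordMatrix_cons, wordMatrix_cons,
    ← Matrix.mul_assoc, letterMatrix_mul_mul_letterMatrix, Matrix.smul_mul, trace_smul,
    ← wordMatrix_cons]
  rfl

lemma wordMatrix_mem_supported (w : List A) (x y : Fin d) :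
    wordMatrix d w x y ∈ MvPolynomial.supported ℕ {i : CoordVar A d | i.1 ∈ w} := by
  induction w generalizing x y with
  | nil =>
    rw [wordMatrix_nil, Matrix.one_apply]
    split_ifs
    · exact one_mem _
    · exact zero_mem _
  | cons c w ih =>
    rw [wordMatrix_cons, Matrix.mul_apply]
    refine sum_mem fun z _ => mul_mem (mul_mem ?_ ?_) ?_
    · exact Algebra.subset_adjoin ⟨_, by simp, rfl⟩
    · exact Algebra.subset_adjoin ⟨_, by simp, rfl⟩
    · exact MvPolynomial.supported_mono (fun i hi => List.mem_cons_of_mem _ hi) (ih z y)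

lemma mem_of_mem_vars_wordTrace (w : List A) (i : CoordVar A d) (hi : i ∈ (wordTrace d w).vars) :
    i.1 ∈ w := by
  have h : wordTrace d w ∈ MvPolynomial.supported ℕ {i : CoordVar A d | i.1 ∈ w} := by
    rw [wordTrace, trace]
    exact sum_mem fun x _ => wordMatrix_mem_supported w x x
  exact MvPolynomial.mem_supported.1 h hi

lemma polyMoment_wordTrace_mul_of_disjoint [Fintype A] (a b : List A)
    (h : a.Disjoint b) :
    polyMoment (wordTrace d a * wordTrace d b) =
      polyMoment (wordTrace d a) * polyMoment (wordTrace d b) :=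
  polyMoment_mul_of_disjoint _ _ fun i hi j hj hij =>
    h (mem_of_mem_vars_wordTrace a i hi) (hij ▸ mem_of_mem_vars_wordTrace b j hj)

lemma polyMoment_wordTrace_nil [Fintype A] :
    polyMoment (wordTrace d ([] : List A)) = d := by
  rw [wordTrace_nil, ← nsmul_one, map_nsmul, polyMoment_one, nsmul_one]

/-! ### Integration by parts on the sphere -/

/-- Adding one to an exponent multiplies the factorial formula by a ratio with denominator `d + |β|
- 1`; the last summand on the right replaces this `-1`. At `β x = 0` the truncated subtraction is
harmless, as its term has the factor `β x`. -/
lemma sphereMoment_single_add (hd : 1 ≤ d) (α β : Fin d → ℕ) (x : Fin d) :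
    (d + ∑ y, (β y : ℝ)) * sphereMoment (α + Pi.single x 1) β =
      β x * sphereMoment α (β - Pi.single x 1) + sphereMoment (α + Pi.single x 1) β := by
  by_cases h : α + Pi.single x 1 = β
  · subst h
    have h1 : α + Pi.single x 1 - Pi.single x 1 = α := by
      ext y; simp
    have h2 : ∏ y, ((((α + Pi.single x 1 : Fin d → ℕ) y).factorial : ℕ) : ℝ) =
        (α x + 1) * ∏ y, (((α y).factorial : ℕ) : ℝ) := by
      rw [← Finset.mul_prod_erase _ _ (Finset.mem_univ x),
        ← Finset.mul_prod_erase _ (fun y => (((α y).factorial : ℕ) : ℝ)) (Finset.mem_univ x)]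
      rw [Finset.prod_congr rfl fun y hy => by
        rw [Pi.add_apply, Pi.single_eq_of_ne (Finset.ne_of_mem_erase hy), add_zero]]
      simp [Nat.factorial_succ]; ring
    have h3 : ∑ y, (α + Pi.single x 1 : Fin d → ℕ) y = ∑ y, α y + 1 := by
      simp [Finset.sum_add_distrib]
    have h4 : ∑ y, (((α + Pi.single x 1 : Fin d → ℕ) y : ℕ) : ℝ) = ∑ y, (α y : ℝ) + 1 := by
      rw [← Nat.cast_sum, h3]; push_cast; rfl
    rw [h1, sphereMoment, sphereMoment, if_pos rfl, if_pos rfl, h2, h3, h4]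
    obtain ⟨e, rfl⟩ : ∃ e, d = e + 1 := ⟨d - 1, by lia⟩
    rw [show ∑ y, α y + 1 + (e + 1) - 1 = (∑ y, α y + e) + 1 by lia, Nat.factorial_succ,
      show ∑ y, α y + (e + 1) - 1 = ∑ y, α y + e by lia]
    have h5 : (((∑ y, α y + e).factorial : ℕ) : ℝ) ≠ 0 := by positivity
    have h6 : (∑ y, (α y : ℝ) + e + 1) ≠ 0 := by positivity
    simp only [Pi.add_apply, Pi.single_eq_same]
    push_cast
    field_simp
    ring
  · have h1 : (β x : ℝ) * sphereMoment α (β - Pi.single x 1) = 0 := by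
      rcases Nat.eq_zero_or_pos (β x) with h0 | h0
      · simp [h0]
      · rw [sphereMoment, if_neg, mul_zero]
        rintro rfl
        apply h
        ext y
        rcases eq_or_ne y x with rfl | hy
        · simp; lia
        · simp [Pi.single_eq_of_ne hy]
    rw [h1, sphereMoment, if_neg h]; simp

lemma monomialMoment_add_single [Fintype A] [DecidableEq A] (hd : 1 ≤ d)
    (α : CoordVar A d →₀ ℕ) (c : A) (x : Fin d) :
    (d + ∑ y, (α (c, y, true) : ℝ)) * monomialMoment (α + Finsupp.single (c, x, false) 1) =
      α (c, x, true) * monomialMoment (α - Finsupp.single (c, x, true) 1) +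
        monomialMoment (α + Finsupp.single (c, x, false) 1) := by
  unfold monomialMoment
  simp only [← Finset.mul_prod_erase _ _ (Finset.mem_univ c)]
  have h1 : ∀ e ∈ Finset.univ.erase c,
      sphereMoment (fun y => (α + Finsupp.single (c, x, false) 1 : CoordVar A d →₀ ℕ) (e, y, false))
        (fun y => (α + Finsupp.single (c, x, false) 1 : CoordVar A d →₀ ℕ) (e, y, true)) =
      sphereMoment (fun y => α (e, y, false)) (fun y => α (e, y, true)) := by
    intro e he
    simp [(Finset.ne_of_mem_erase he).symm]
  have h2 : ∀ e ∈ Finset.univ.erase c,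
      sphereMoment (fun y => (α - Finsupp.single (c, x, true) 1 : CoordVar A d →₀ ℕ) (e, y, false))
        (fun y => (α - Finsupp.single (c, x, true) 1 : CoordVar A d →₀ ℕ) (e, y, true)) =
      sphereMoment (fun y => α (e, y, false)) (fun y => α (e, y, true)) := by
    intro e he
    simp [(Finset.ne_of_mem_erase he).symm]
  rw [Finset.prod_congr rfl h1, Finset.prod_congr rfl h2]
  have h3 : (fun y => (α + Finsupp.single (c, x, false) 1 : CoordVar A d →₀ ℕ) (c, y, false)) =
      (fun y => α (c, y, false)) + Pi.single x 1 := by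
    ext y; simp [Finsupp.single_apply, Pi.single_apply, eq_comm]
  have h4 : (fun y => (α + Finsupp.single (c, x, false) 1 : CoordVar A d →₀ ℕ) (c, y, true)) =
      (fun y => α (c, y, true)) := by
    ext y; simp
  have h5 : (fun y => (α - Finsupp.single (c, x, true) 1 : CoordVar A d →₀ ℕ) (c, y, false)) =
      (fun y => α (c, y, false)) := by
    ext y; simp
  have h6 : (fun y => (α - Finsupp.single (c, x, true) 1 : CoordVar A d →₀ ℕ) (c, y, true)) =
      (fun y => α (c, y, true)) - Pi.single x 1 := by
    ext y; simp [Finsupp.single_apply, Pi.single_apply, eq_comm]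
  rw [h3, h4, h5, h6]
  linear_combination (∏ e ∈ Finset.univ.erase c,
    sphereMoment (fun y => α (e, y, false)) (fun y => α (e, y, true))) *
    sphereMoment_single_add hd (fun y => α (c, y, false)) (fun y => α (c, y, true)) x

/-- The Euler derivation in the conjugate coordinates of the vector `v c`. -/
noncomputable def eulerConj (d : ℕ) (c : A) :
    Derivation ℕ (MvPolynomial (CoordVar A d) ℕ) (MvPolynomial (CoordVar A d) ℕ) :=
  ∑ y, (MvPolynomial.X (c, y, true) : MvPolynomial (CoordVar A d) ℕ) •
    MvPolynomial.pderiv (c, y, true)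

lemma eulerConj_apply (c : A) (Q : MvPolynomial (CoordVar A d) ℕ) :
    eulerConj d c Q = ∑ y, MvPolynomial.X (c, y, true) * MvPolynomial.pderiv (c, y, true) Q := by
  rw [eulerConj]
  erw [← Derivation.coeFnAddMonoidHom_apply]
  simp [Derivation.coeFnAddMonoidHom]

/-- Integration by parts on the sphere. -/
lemma polyMoment_X_mul [Fintype A] [DecidableEq A] (hd : 1 ≤ d) (c : A) (x : Fin d)
    (Q : MvPolynomial (CoordVar A d) ℕ) :
    polyMoment (MvPolynomial.X (c, x, false) * (d • Q + eulerConj d c Q)) =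
      polyMoment (MvPolynomial.pderiv (c, x, true) Q) +
        polyMoment (MvPolynomial.X (c, x, false) * Q) := by
  induction Q using MvPolynomial.induction_on' with
  | monomial α n =>
    have h1 : d • MvPolynomial.monomial α n + eulerConj d c (MvPolynomial.monomial α n) =
        (d + ∑ y, α (c, y, true)) • MvPolynomial.monomial α n := by
      simp only [eulerConj_apply, MvPolynomial.X_mul_pderiv_monomial]
      rw [← Finset.sum_smul, add_smul]
    have h2 : MvPolynomial.X (c, x, false) * MvPolynomial.monomial α n =
        MvPolynomial.monomial (α + Finsupp.single (c, x, false) 1) n := by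
      rw [MvPolynomial.X, MvPolynomial.monomial_mul, one_mul, add_comm]
    rw [h1, mul_smul_comm, h2, map_smul, MvPolynomial.pderiv_monomial, polyMoment_monomial,
      polyMoment_monomial, nsmul_eq_mul]
    push_cast
    linear_combination (n : ℝ) * monomialMoment_add_single hd α c x
  | add P Q hP hQ =>
    simp only [map_add, smul_add, mul_add] at hP hQ ⊢
    linear_combination hP + hQ

lemma derivation_matrix_mul_apply
    (D : Derivation ℕ (MvPolynomial (CoordVar A d) ℕ) (MvPolynomial (CoordVar A d) ℕ))
    (M N : Matrix (Fin d) (Fin d) (MvPolynomial (CoordVar A d) ℕ)) :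
    (M * N).map D = M.map D * N + M * N.map D := by
  ext1 x y
  simp only [Matrix.map_apply, Matrix.mul_apply, Matrix.add_apply, map_sum, Derivation.leibniz,
    smul_eq_mul, ← Finset.sum_add_distrib]
  refine Finset.sum_congr rfl fun z _ => ?_
  ring

lemma map_derivation_one
    (D : Derivation ℕ (MvPolynomial (CoordVar A d) ℕ) (MvPolynomial (CoordVar A d) ℕ)) :
    (1 : Matrix (Fin d) (Fin d) (MvPolynomial (CoordVar A d) ℕ)).map D = 0 := by
  ext1 x y
  rw [Matrix.map_apply, Matrix.one_apply]
  split_ifs <;> simp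

lemma map_pderiv_letterMatrix [DecidableEq A] (c e : A) (x : Fin d) :
    (letterMatrix d e).map (MvPolynomial.pderiv (c, x, true)) =
      if e = c then vecMulVec (fun z => MvPolynomial.X (c, z, false)) (Pi.single x 1) else 0 := by
  ext1 y z
  simp only [letterMatrix, Matrix.map_apply, vecMulVec_apply, Derivation.leibniz,
    MvPolynomial.pderiv_X, smul_eq_mul]
  by_cases h : e = c
  · subst h
    simp [Pi.single_apply, vecMulVec_apply]
  · simp [h]

lemma map_pderiv_wordMatrix [DecidableEq A] (c : A) (x : Fin d) (w : List A) :
    (wordMatrix d w).map (MvPolynomial.pderiv (c, x, true)) =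
      ∑ i ∈ Finset.range w.length, if w[i]? = some c then
        wordMatrix d (w.take i) *
          vecMulVec (fun z => MvPolynomial.X (c, z, false)) (Pi.single x 1) *
          wordMatrix d (w.drop (i + 1)) else 0 := by
  induction w with
  | nil => simp [wordMatrix_nil, map_derivation_one]
  | cons e w ih =>
    rw [wordMatrix_cons, derivation_matrix_mul_apply, ih, List.length_cons,
      Finset.sum_range_succ', map_pderiv_letterMatrix, add_comm, Finset.mul_sum]
    congr 1
    · refine Finset.sum_congr rfl fun i _ => ?_
      simp only [List.getElem?_cons_succ, List.take_succ_cons, List.drop_succ_cons,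
        wordMatrix_cons, Matrix.mul_assoc, mul_ite, mul_zero]
    · simp [wordMatrix_nil, ite_mul]

lemma eulerConj_X_true [DecidableEq A] (c e : A) (y : Fin d) :
    eulerConj d c (MvPolynomial.X (e, y, true)) =
      if e = c then MvPolynomial.X (e, y, true) else 0 := by
  rw [eulerConj_apply]
  by_cases h : e = c
  · subst h; simp [MvPolynomial.pderiv_X, Pi.single_apply]
  · simp [h, MvPolynomial.pderiv_X]

lemma eulerConj_X_false [DecidableEq A] (c e : A) (y : Fin d) :
    eulerConj d c (MvPolynomial.X (e, y, false)) = 0 := by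
  rw [eulerConj_apply]
  simp [MvPolynomial.pderiv_X]

/-- Euler's identity: the entries are homogeneous of degree `w.count c` in the conjugate coordinates
of `v c`. -/
lemma map_eulerConj_wordMatrix [DecidableEq A] (c : A) (w : List A) :
    (wordMatrix d w).map (eulerConj d c) = w.count c • wordMatrix d w := by
  induction w with
  | nil => simp [wordMatrix_nil, map_derivation_one]
  | cons e w ih =>
    have h : (letterMatrix d e).map (eulerConj d c) =
        (if e = c then 1 else 0) • letterMatrix d e := by
      ext1 y z
      simp only [letterMatrix, Matrix.map_apply, vecMulVec_apply, Derivation.leibniz,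
        eulerConj_X_true, eulerConj_X_false, Matrix.smul_apply]
      split_ifs <;> simp
    rw [wordMatrix_cons, derivation_matrix_mul_apply, ih, h, List.count_cons, add_smul,
      Matrix.smul_mul, Matrix.mul_smul, add_comm]
    simp

/-- The Schwinger–Dyson equation for words in rank-one projections. -/
lemma polyMoment_wordTrace_cons [Fintype A] [DecidableEq A] (hd : 1 ≤ d) (c : A) (w : List A) :
    ((d : ℝ) + w.count c) * polyMoment (wordTrace d (c :: w)) =
      polyMoment (wordTrace d w) + ∑ i ∈ Finset.range w.length, if w[i]? = some c then
        polyMoment (wordTrace d (c :: w.take i) * wordTrace d (w.drop (i + 1))) else 0 := by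
  let Q : Fin d → MvPolynomial (CoordVar A d) ℕ :=
    fun x => ∑ y, MvPolynomial.X (c, y, true) * wordMatrix d w y x
  have hE : ∀ x, eulerConj d c (Q x) = (w.count c + 1) • Q x := by
    intro x
    simp only [Q, map_sum, Derivation.leibniz, eulerConj_X_true, if_true, Finset.smul_sum]
    refine Finset.sum_congr rfl fun y _ => ?_
    have h := congrFun (congrFun (map_eulerConj_wordMatrix (d := d) c w) y) x
    rw [Matrix.map_apply, Matrix.smul_apply] at h
    rw [h]
    simp only [smul_eq_mul, nsmul_eq_mul]
    push_cast; ring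
  have hD : ∑ x, MvPolynomial.pderiv (c, x, true) (Q x) = wordTrace d w +
      ∑ i ∈ Finset.range w.length, if w[i]? = some c then
        wordTrace d (c :: w.take i) * wordTrace d (w.drop (i + 1)) else 0 := by
    have h1 : ∀ x, MvPolynomial.pderiv (c, x, true) (Q x) = wordMatrix d w x x +
        ∑ i ∈ Finset.range w.length, if w[i]? = some c then
          wordTrace d (c :: w.take i) * wordMatrix d (w.drop (i + 1)) x x else 0 := by
      intro x
      -- The derivative hits either the explicit conjugate coordinate, which leaves a diagonal entry
      -- of the word, or an occurrence of `c` in `w`, which cuts the word there.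
      simp only [Q, map_sum, Derivation.leibniz, Finset.sum_add_distrib, smul_eq_mul]
      rw [add_comm]
      congr 1
      · simp [MvPolynomial.pderiv_X, Pi.single_apply]
      · have h2 : ∀ y, MvPolynomial.pderiv (c, x, true) (wordMatrix d w y x) =
            ∑ i ∈ Finset.range w.length, if w[i]? = some c then
              (wordMatrix d (w.take i) *ᵥ fun z => MvPolynomial.X (c, z, false)) y *
              wordMatrix d (w.drop (i + 1)) x x else 0 := by
          intro y
          have h := congrFun (congrFun (map_pderiv_wordMatrix c x w) y) x
          rw [Matrix.map_apply] at h
          rw [h, Matrix.sum_apply]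
          refine Finset.sum_congr rfl fun i _ => ?_
          split_ifs
          · rw [mul_vecMulVec, vecMulVec_mul, vecMulVec_apply, single_one_vecMul]; rfl
          · rfl
        simp only [h2, Finset.mul_sum]
        rw [Finset.sum_comm]
        refine Finset.sum_congr rfl fun i _ => ?_
        split_ifs
        · rw [wordTrace_cons_eq_dotProduct, dotProduct, Finset.sum_mul]
          exact Finset.sum_congr rfl fun y _ => by ring
        · simp
    simp only [h1, Finset.sum_add_distrib]
    congr 1
    rw [Finset.sum_comm]
    refine Finset.sum_congr rfl fun i _ => ?_
    split_ifs
    · rw [← Finset.mul_sum]; rfl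
    · simp
  -- `Q x` has degree `w.count c + 1`; the extra `1` cancels the last term of `polyMoment_X_mul`.
  have key : ∀ x, ((d : ℝ) + w.count c) * polyMoment (MvPolynomial.X (c, x, false) * Q x) =
      polyMoment (MvPolynomial.pderiv (c, x, true) (Q x)) := by
    intro x
    have h := polyMoment_X_mul hd c x (Q x)
    rw [hE, ← add_smul, mul_smul_comm, map_smul, nsmul_eq_mul] at h
    push_cast at h
    linear_combination h
  rw [wordTrace_cons, map_sum, Finset.mul_sum, Finset.sum_congr rfl fun x _ => key x, ← map_sum,
    hD, map_add, map_sum]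
  congr 1
  refine Finset.sum_congr rfl fun i _ => ?_
  split_ifs <;> simp

end

/-! ### Sums over words -/

/-- The words of length `n`. -/
def words (A : Type*) [Fintype A] (n : ℕ) : Finset (List A) :=
  (Finset.univ : Finset (Fin n → A)).map ⟨List.ofFn, List.ofFn_injective⟩

section

variable {A : Type*} [Fintype A]

lemma mem_words {n : ℕ} {w : List A} : w ∈ words A n ↔ w.length = n := by
  simp only [words, Finset.mem_map, Finset.mem_univ, true_and, Function.Embedding.coeFn_mk]
  constructor
  · rintro ⟨f, rfl⟩
    exact List.length_ofFn
  · rintro rfl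
    exact ⟨w.get, List.ofFn_get w⟩

lemma words_zero : words A 0 = {[]} := by
  ext w; simp [mem_words]

lemma sum_words_succ {M : Type*} [AddCommMonoid M] (n : ℕ) (f : List A → M) :
    ∑ w ∈ words A (n + 1), f w = ∑ c, ∑ w ∈ words A n, f (c :: w) := by
  rw [← Finset.sum_product']
  symm
  refine Finset.sum_bij (fun x _ => x.1 :: x.2) ?_ ?_ ?_ ?_
  · rintro ⟨c, w⟩ h
    simpa [mem_words] using h
  · rintro ⟨c, w⟩ _ ⟨e, u⟩ _ h
    simpa using h
  · intro w hw
    rw [mem_words] at hw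
    obtain ⟨c, u, rfl⟩ := List.exists_cons_of_length_eq_add_one hw
    exact ⟨(c, u), by simpa [mem_words] using hw, rfl⟩
  · intros; rfl

lemma sum_pow_eq_sum_words {R : Type*} [Semiring R] (f : A → R) (n : ℕ) :
    (∑ c, f c) ^ n = ∑ w ∈ words A n, (w.map f).prod := by
  induction n with
  | zero => simp [words_zero]
  | succ n ih =>
    rw [pow_succ', ih, sum_words_succ, Finset.sum_mul_sum]
    simp

end

/-! ### Reduction of the moments to words -/

/-- The tensor product of `k` square matrices, indexed by multi-indices. -/
def tensorMatrix {d k : ℕ} (M : Fin k → Matrix (Fin d) (Fin d) ℂ) :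
    Matrix (Fin k → Fin d) (Fin k → Fin d) ℂ :=
  Matrix.of fun I J => ∏ j, M j (I j) (J j)

lemma tensorMatrix_mul {d k : ℕ} (M N : Fin k → Matrix (Fin d) (Fin d) ℂ) :
    tensorMatrix (fun j => M j * N j) = tensorMatrix M * tensorMatrix N := by
  ext I J
  simp only [tensorMatrix, Matrix.of_apply, Matrix.mul_apply, Finset.prod_univ_sum,
    ← Finset.prod_mul_distrib, Fintype.piFinset_univ]

lemma tensorMatrix_one {d k : ℕ} :
    tensorMatrix (fun _ : Fin k => (1 : Matrix (Fin d) (Fin d) ℂ)) = 1 := by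
  ext I J
  simp only [tensorMatrix, Matrix.of_apply, Matrix.one_apply]
  split_ifs with h
  · subst h; simp
  · obtain ⟨j, hj⟩ := Function.ne_iff.1 h
    exact Finset.prod_eq_zero (Finset.mem_univ j) (if_neg hj)

lemma trace_tensorMatrix {d k : ℕ} (M : Fin k → Matrix (Fin d) (Fin d) ℂ) :
    (tensorMatrix M).trace = ∏ j, (M j).trace := by
  simp only [Matrix.trace, tensorMatrix, Matrix.diag_apply, Matrix.of_apply, Finset.prod_univ_sum,
    Fintype.piFinset_univ]

lemma ketBra_tensorVec {d k : ℕ} (v : Fin k → UnitVec d) :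
    ketBra (tensorVec v) = tensorMatrix fun j => ketBra ((v j).1 : Fin d → ℂ) := by
  ext I J
  simp [ketBra, tensorVec, tensorMatrix, Matrix.vecMulVec_apply, Finset.prod_mul_distrib]

lemma aeval_mapMatrix_letterMatrix {A : Type*} {d : ℕ} (v : A → UnitVec d) (c : A) :
    (MvPolynomial.aeval (coordValue v)).mapMatrix (letterMatrix d c) =
      ketBra ((v c).1 : Fin d → ℂ) := by
  ext x y
  simp [letterMatrix, ketBra, Matrix.vecMulVec_apply, coordValue]

lemma prod_map_ketBra_tensorVec {p d k : ℕ} (v : Fin p → Fin k → UnitVec d) (w : List (Fin p)) :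
    (w.map fun s => ketBra (tensorVec (v s))).prod = tensorMatrix fun j =>
      (MvPolynomial.aeval (coordValue fun s => v s j)).mapMatrix (wordMatrix d w) := by
  induction w with
  | nil => simp [wordMatrix_nil, tensorMatrix_one]
  | cons c w ih =>
    rw [List.map_cons, List.prod_cons, ih, ketBra_tensorVec, ← tensorMatrix_mul]
    simp only [wordMatrix_cons, map_mul, aeval_mapMatrix_letterMatrix]

lemma trace_stateSum_pow {p d k : ℕ} (v : Fin p → Fin k → UnitVec d) (m : ℕ) :
    (stateSum v ^ m).trace = ∑ w ∈ words (Fin p) m,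
      ∏ j, MvPolynomial.aeval (coordValue fun s => v s j) (wordTrace d w) := by
  rw [stateSum, sum_pow_eq_sum_words, Matrix.trace_sum]
  refine Finset.sum_congr rfl fun w _ => ?_
  rw [prod_map_ketBra_tensorVec, trace_tensorMatrix]
  refine Finset.prod_congr rfl fun j _ => ?_
  simp [wordTrace, Matrix.trace]

/-- The tensor factors are independent and identically distributed, whence the `k`-th power. -/
lemma normMoment_eq {p d k : ℕ} (hd : 1 ≤ d) (m : ℕ) :
    normMoment p d k m =
      (∑ w ∈ words (Fin p) m, polyMoment (wordTrace d w) ^ k) / (d : ℝ) ^ k := by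
  rw [normMoment, one_div, inv_mul_eq_div]
  congr 1
  have hI : ∀ w ∈ words (Fin p) m, Integrable (fun v : Fin p → Fin k → UnitVec d =>
      ∏ j, MvPolynomial.aeval (coordValue fun s => v s j) (wordTrace d w))
      (productStateLaw p d k) := fun w _ => integrable_prod_aeval hd fun _ => wordTrace d w
  simp only [trace_stateSum_pow]
  have h := integral_re (𝕜 := ℂ) (integrable_finsetSum _ hI)
  simp only [RCLike.re_eq_complex_re] at h
  rw [h, integral_finsetSum _ hI]
  simp only [integral_prod_aeval hd fun _ => wordTrace d _]
  rw [← Complex.ofReal_sum, Complex.ofReal_re]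
  simp

/-! ### The recursion for the moments -/

/-- Jensen's inequality for powers, with weights of total mass at most `W`. -/
lemma pow_div_le_sum_div {ι : Type*} (s : Finset ι) (ω z : ι → ℝ) (W : ℝ) (k : ℕ) (hk : 1 ≤ k)
    (hω : ∀ i ∈ s, 0 ≤ ω i) (hz : ∀ i ∈ s, 0 ≤ z i) (hW : 0 < W) (hsum : ∑ i ∈ s, ω i ≤ W) :
    ((∑ i ∈ s, ω i * z i) / W) ^ k ≤ (∑ i ∈ s, ω i * z i ^ k) / W := by
  set V := ∑ i ∈ s, ω i with hV
  have h5 : 0 ≤ ∑ i ∈ s, ω i * z i ^ k :=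
    Finset.sum_nonneg fun i hi => mul_nonneg (hω i hi) (pow_nonneg (hz i hi) k)
  rcases (Finset.sum_nonneg hω).eq_or_lt with h0 | h0
  · have h1 := (Finset.sum_eq_zero_iff_of_nonneg hω).1 h0.symm
    have h2 : ∑ i ∈ s, ω i * z i = 0 := Finset.sum_eq_zero fun i hi => by rw [h1 i hi, zero_mul]
    rw [h2, zero_div, zero_pow (by lia)]
    exact div_nonneg h5 hW.le
  · rw [← hV] at h0
    have h2 := Real.pow_arith_mean_le_arith_mean_pow s (fun i => ω i / V) z
      (fun i hi => div_nonneg (hω i hi) h0.le) (by rw [← Finset.sum_div, ← hV, div_self h0.ne']) hz k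
    simp only [div_mul_eq_mul_div, ← Finset.sum_div] at h2
    -- Mass below `W` only helps: as `k ≥ 1`, the factor `(V / W) ^ k` is at most `V / W`.
    have h3 : (V / W) ^ k ≤ V / W :=
      pow_le_of_le_one (div_nonneg h0.le hW.le) ((div_le_one hW).2 hsum) (by lia)
    have h4 : 0 ≤ (∑ i ∈ s, ω i * z i) / V :=
      div_nonneg (Finset.sum_nonneg fun i hi => mul_nonneg (hω i hi) (hz i hi)) h0.le
    calc ((∑ i ∈ s, ω i * z i) / W) ^ k
        = (V / W) ^ k * ((∑ i ∈ s, ω i * z i) / V) ^ k := by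
          rw [← mul_pow]; congr 1; field_simp
      _ ≤ (V / W) * ((∑ i ∈ s, ω i * z i ^ k) / V) :=
          mul_le_mul h3 h2 (pow_nonneg h4 k) (div_nonneg h0.le hW.le)
      _ = _ := by field_simp

lemma sum_le_sum_of_injOn {ι κ : Type*} (s : Finset ι) (t : Finset κ) (f : ι → ℝ)
    (g : κ → ℝ) (e : ι → κ) (he : ∀ i ∈ s, e i ∈ t) (hinj : Set.InjOn e s)
    (hfg : ∀ i ∈ s, f i ≤ g (e i)) (hg : ∀ j ∈ t, 0 ≤ g j) : ∑ i ∈ s, f i ≤ ∑ j ∈ t, g j := by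
  classical
  calc ∑ i ∈ s, f i ≤ ∑ i ∈ s, g (e i) := Finset.sum_le_sum hfg
    _ = ∑ j ∈ s.image e, g j := (Finset.sum_image hinj).symm
    _ ≤ ∑ j ∈ t, g j := Finset.sum_le_sum_of_subset_of_nonneg
        (Finset.image_subset_iff.2 he) fun j hj _ => hg j hj

section

variable {A : Type*}

lemma card_filter_getElem?_eq_count [DecidableEq A] (c : A) (w : List A) :
    ((Finset.range w.length).filter fun i => w[i]? = some c).card = w.count c := by
  rw [Finset.card_filter]
  induction w with
  | nil => simp
  | cons e w ih =>
    rw [List.length_cons, Finset.sum_range_succ', List.count_cons, ← ih]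
    simp

lemma not_disjoint_of_lt_of_getElem? (c : A) (w : List A) {i j : ℕ} (hij : i < j)
    (hj : w[j]? = some c) : ¬ (c :: w.take i).Disjoint (w.drop (i + 1)) := by
  intro h
  refine h List.mem_cons_self ?_
  rw [List.mem_iff_getElem?]
  exact ⟨j - (i + 1), by rw [List.getElem?_drop, ← hj]; congr 1; lia⟩

open Classical in
/-- The convexity estimate for a word with given first letter. -/
lemma polyMoment_wordTrace_cons_pow_le [Fintype A] [DecidableEq A] {d k : ℕ} (hd : 1 ≤ d) (hk : 1 ≤ k) (c : A)
    (w : List A) :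
    polyMoment (wordTrace d (c :: w)) ^ k ≤
      (if c ∈ w then polyMoment (wordTrace d w) ^ k / d
        else polyMoment (wordTrace d w) ^ k / (d : ℝ) ^ k) +
      ∑ i ∈ Finset.range w.length, if w[i]? = some c then
        ((polyMoment (wordTrace d (c :: w.take i)) ^ k *
            polyMoment (wordTrace d (w.drop (i + 1))) ^ k) / (d : ℝ) ^ k +
          (if (c :: w.take i).Disjoint (w.drop (i + 1)) then 0 else
            polyMoment (wordTrace d (c :: w.take i) * wordTrace d (w.drop (i + 1))) ^ k) / d)
        else 0 := by
  have hd0 : (0 : ℝ) < d := by exact_mod_cast hd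
  have hd1 : (1 : ℝ) ≤ d := by exact_mod_cast hd
  have hSD := polyMoment_wordTrace_cons hd c w
  split_ifs with hc
  · set O := (Finset.range w.length).filter fun i => w[i]? = some c with hO
    set W : ℝ := d + w.count c with hW
    have hW0 : 0 < W := by positivity
    have hdW : (d : ℝ) ≤ W := by rw [hW]; linarith [(Nat.cast_nonneg (w.count c) : (0 : ℝ) ≤ _)]
    let D : ℕ → Prop := fun i => (c :: w.take i).Disjoint (w.drop (i + 1))
    let P : ℕ → ℝ := fun i => polyMoment (wordTrace d (c :: w.take i) * wordTrace d (w.drop (i + 1)))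
    have hP : ∀ i, 0 ≤ P i := fun i => polyMoment_nonneg _
    -- `none` stands for the term `T(w)`. Weight `d` at a disjoint cut turns its contribution into
    -- `(P i / d) ^ k`, the exact order of the main term; all other terms keep weight `1` and gain
    -- only `1 / d`.
    let ω : Option ℕ → ℝ := fun o => o.elim 1 fun i => if D i then (d : ℝ) else 1
    let z : Option ℕ → ℝ := fun o => o.elim (polyMoment (wordTrace d w)) fun i =>
      P i / (if D i then (d : ℝ) else 1)
    have hω : ∀ o ∈ O.insertNone, 0 ≤ ω o := by
      rintro (_ | i) _
      · exact zero_le_one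
      · simp only [ω, Option.elim]; split_ifs <;> positivity
    have hz : ∀ o ∈ O.insertNone, 0 ≤ z o := by
      rintro (_ | i) _
      · exact polyMoment_nonneg _
      · simp only [z, Option.elim]
        exact div_nonneg (hP i) (by split_ifs <;> positivity)
    have hsum : ∑ o ∈ O.insertNone, ω o ≤ W := by
      rw [Finset.sum_insertNone]
      simp only [ω, Option.elim]
      have h1 : ∀ i ∈ O, (if D i then (d : ℝ) else 1) = 1 + if D i then (d : ℝ) - 1 else 0 := by
        intro i _; split_ifs <;> ring
      rw [Finset.sum_congr rfl h1, Finset.sum_add_distrib, ← Finset.sum_filter,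
        Finset.sum_const, Finset.sum_const, nsmul_eq_mul, nsmul_eq_mul, hO,
        card_filter_getElem?_eq_count, ← hO, mul_one]
      -- Only the last occurrence of `c` can give a disjoint cut, so the weights add up to at most
      -- `1 + w.count c + (d - 1) = W`.
      have h2 : (O.filter D).card ≤ 1 := by
        rw [Finset.card_le_one]
        intro i hi j hj
        simp only [hO, Finset.mem_filter] at hi hj
        rcases lt_trichotomy i j with h | h | h
        · exact absurd hi.2 (not_disjoint_of_lt_of_getElem? c w h hj.1.2)
        · exact h
        · exact absurd hj.2 (not_disjoint_of_lt_of_getElem? c w h hi.1.2)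
      have h3 : ((O.filter D).card : ℝ) ≤ 1 := by exact_mod_cast h2
      nlinarith
    have hJ := pow_div_le_sum_div O.insertNone ω z W k hk hω hz hW0 hsum
    rw [Finset.sum_insertNone, Finset.sum_insertNone] at hJ
    have hL : polyMoment (wordTrace d (c :: w)) =
        (ω none * z none + ∑ i ∈ O, ω (some i) * z (some i)) / W := by
      rw [eq_div_iff hW0.ne', mul_comm, hSD, ← Finset.sum_filter]
      simp only [ω, z, Option.elim, one_mul]
      congr 1
      refine Finset.sum_congr rfl fun i _ => ?_
      rw [mul_div_cancel₀]
      split_ifs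
      · exact hd0.ne'
      · exact one_ne_zero
    rw [hL]
    refine hJ.trans ?_
    rw [add_div, Finset.sum_div, ← Finset.sum_filter]
    refine add_le_add ?_ (Finset.sum_le_sum fun i _ => ?_)
    · simp only [ω, z, Option.elim, one_mul]
      have := pow_nonneg (polyMoment_nonneg (wordTrace d w)) k
      gcongr
    · simp only [ω, z, Option.elim]
      have hPi := pow_nonneg (hP i) k
      by_cases hDi : D i
      · rw [if_pos hDi, if_pos hDi, zero_div, add_zero, ← mul_pow,
          ← polyMoment_wordTrace_mul_of_disjoint _ _ hDi, ← div_pow]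
        have h5 : 0 ≤ (P i / d) ^ k :=
          pow_nonneg (div_nonneg (hP i) hd0.le) k
        rw [div_le_iff₀ hW0, mul_comm]
        exact mul_le_mul_of_nonneg_left hdW h5
      · rw [if_neg hDi, if_neg hDi, div_one, one_mul]
        have h6 : 0 ≤ polyMoment (wordTrace d (c :: w.take i)) ^ k *
            polyMoment (wordTrace d (w.drop (i + 1))) ^ k / (d : ℝ) ^ k :=
          div_nonneg (mul_nonneg (pow_nonneg (polyMoment_nonneg _) k)
            (pow_nonneg (polyMoment_nonneg _) k)) (by positivity)
        have h7 : P i ^ k / W ≤ P i ^ k / d := by gcongr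
        exact h7.trans (le_add_of_nonneg_left h6)
  · have h0 : w.count c = 0 := List.count_eq_zero.2 hc
    have h1 : ∀ i, w[i]? ≠ some c := fun i hi => hc (List.mem_of_getElem? hi)
    simp only [h1, if_false, Finset.sum_const_zero, add_zero, h0, Nat.cast_zero] at hSD ⊢
    rw [← hSD, mul_pow, mul_div_cancel_left₀ _ (pow_ne_zero k hd0.ne')]

variable [Fintype A]

/-- A word with two equal letters at positions `0` and `i + 1` is cut there into two words. -/
lemma sum_words_cut_le [DecidableEq A] (n i : ℕ) (hi : i < n) (F : List A → List A → ℝ) (hF : ∀ a b, 0 ≤ F a b) :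
    ∑ c, ∑ w ∈ words A n, (if w[i]? = some c then F (c :: w.take i) (w.drop (i + 1)) else 0) ≤
      ∑ a ∈ words A (i + 1), ∑ b ∈ words A (n - 1 - i), F a b := by
  rw [← Finset.sum_product', ← Finset.sum_product', ← Finset.sum_filter]
  refine sum_le_sum_of_injOn _ _ _ _ (fun x => (x.1 :: x.2.take i, x.2.drop (i + 1))) ?_ ?_
    (fun _ _ => le_rfl) (fun _ _ => hF _ _)
  · rintro ⟨c, w⟩ h
    simp only [Finset.mem_filter, Finset.mem_product, mem_words, Finset.mem_univ, true_and] at h ⊢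
    simp only [List.length_cons, List.length_take, List.length_drop]
    lia
  · rintro ⟨c, w⟩ h ⟨e, u⟩ h' heq
    simp only [Finset.coe_filter, Finset.mem_product, mem_words, Finset.mem_univ, true_and,
      Set.mem_ofPred_eq] at h h'
    simp only [Prod.mk.injEq, List.cons.injEq] at heq ⊢
    obtain ⟨⟨rfl, h2⟩, h3⟩ := heq
    refine ⟨rfl, ?_⟩
    -- The letter dropped at position `i` is `c`, which is still the head of the first piece, so the
    -- cut loses nothing.
    have key : ∀ v : List A, v[i]? = some c → v = v.take i ++ c :: v.drop (i + 1) := by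
      intro v hv
      obtain ⟨hv1, hv2⟩ := List.getElem?_eq_some_iff.1 hv
      rw [← hv2, ← List.drop_eq_getElem_cons, List.take_append_drop]
    rw [key w h.2, key u h'.2, h2, h3]

open Classical in
/-- Two words with a common letter merge into one. -/
lemma sum_words_not_disjoint_le {d : ℕ} (k r s : ℕ) :
    ∑ a ∈ words A r, ∑ b ∈ words A s, (if a.Disjoint b then 0 else
        polyMoment (wordTrace d a * wordTrace d b) ^ k) ≤
      r * s * ∑ w ∈ words A (r + s), polyMoment (wordTrace d w) ^ k := by
  have hnn : ∀ w : List A, 0 ≤ polyMoment (wordTrace d w) ^ k :=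
    fun w => pow_nonneg (polyMoment_nonneg _) k
  have h1 : ∀ a ∈ words A r, ∀ b ∈ words A s, (if a.Disjoint b then 0 else
      polyMoment (wordTrace d a * wordTrace d b) ^ k) ≤ ∑ u ∈ Finset.range r,
      ∑ v ∈ Finset.range s, polyMoment (wordTrace d (a.rotate u ++ b.rotate v)) ^ k := by
    intro a ha b hb
    rw [mem_words] at ha hb
    split_ifs with h
    · exact Finset.sum_nonneg fun _ _ => Finset.sum_nonneg fun _ _ => hnn _
    · simp only [List.Disjoint, not_forall, not_false_eq_true] at h
      obtain ⟨c, hca, hcb, -⟩ := h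
      obtain ⟨u, hu, rfl⟩ := List.mem_iff_getElem.1 hca
      obtain ⟨v, hv, hvc⟩ := List.mem_iff_getElem.1 hcb
      -- Rotating both words brings the common letter to the front, where the loops can be merged;
      -- the positions `u` and `v` cost the factor `r * s`.
      have e1 : a.rotate u = a[u] :: (a.drop (u + 1) ++ a.take u) := by
        rw [List.rotate_eq_drop_append_take hu.le, List.drop_eq_getElem_cons hu, List.cons_append]
      have e2 : b.rotate v = a[u] :: (b.drop (v + 1) ++ b.take v) := by
        rw [List.rotate_eq_drop_append_take hv.le, List.drop_eq_getElem_cons hv, List.cons_append,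
          hvc]
      have e3 : wordTrace d a * wordTrace d b = wordTrace d (a.rotate u ++ b.rotate v) := by
        rw [← wordTrace_rotate a u, ← wordTrace_rotate b v, e1, e2,
          wordTrace_cons_mul_wordTrace_cons]
      rw [e3]
      refine le_trans ?_ (Finset.single_le_sum
        (f := fun u => ∑ v ∈ Finset.range s,
          polyMoment (wordTrace d (a.rotate u ++ b.rotate v)) ^ k)
        (fun _ _ => Finset.sum_nonneg fun _ _ => hnn _) (Finset.mem_range.2 (ha ▸ hu)))
      exact Finset.single_le_sum
        (f := fun v => polyMoment (wordTrace d (a.rotate u ++ b.rotate v)) ^ k)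
        (fun _ _ => hnn _) (Finset.mem_range.2 (hb ▸ hv))
  calc _ ≤ ∑ a ∈ words A r, ∑ b ∈ words A s, ∑ u ∈ Finset.range r, ∑ v ∈ Finset.range s,
        polyMoment (wordTrace d (a.rotate u ++ b.rotate v)) ^ k :=
        Finset.sum_le_sum fun a ha => Finset.sum_le_sum fun b hb => h1 a ha b hb
    _ = ∑ u ∈ Finset.range r, ∑ v ∈ Finset.range s, ∑ a ∈ words A r, ∑ b ∈ words A s,
        polyMoment (wordTrace d (a.rotate u ++ b.rotate v)) ^ k := by
        rw [Finset.sum_congr rfl fun a _ => Finset.sum_comm, Finset.sum_comm]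
        refine Finset.sum_congr rfl fun u _ => ?_
        rw [Finset.sum_congr rfl fun a _ => Finset.sum_comm, Finset.sum_comm]
    _ ≤ ∑ u ∈ Finset.range r, ∑ v ∈ Finset.range s, ∑ w ∈ words A (r + s),
        polyMoment (wordTrace d w) ^ k := by
        refine Finset.sum_le_sum fun u _ => Finset.sum_le_sum fun v _ => ?_
        rw [← Finset.sum_product']
        refine sum_le_sum_of_injOn _ _ _ _ (fun x => x.1.rotate u ++ x.2.rotate v) ?_ ?_
          (fun _ _ => le_rfl) (fun _ _ => hnn _)
        · rintro ⟨a, b⟩ h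
          simpa [mem_words] using congrArg₂ (· + ·) (mem_words.1 (Finset.mem_product.1 h).1)
            (mem_words.1 (Finset.mem_product.1 h).2)
        · rintro ⟨a, b⟩ h ⟨a', b'⟩ h' heq
          simp only [Finset.coe_product, Set.mem_prod, Finset.mem_coe, mem_words] at h h'
          obtain ⟨h2, h3⟩ := List.append_inj heq (by simp [h.1, h'.1])
          exact Prod.ext (List.rotate_injective u h2) (List.rotate_injective v h3)
    _ = _ := by simp [mul_assoc]

open Classical in
/-- The recursion for the power sums of the word moments. -/
lemma sum_words_polyMoment_pow_le [DecidableEq A] {d k : ℕ} (hd : 1 ≤ d) (hk : 1 ≤ k) (n : ℕ) :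
    ∑ w ∈ words A (n + 1), polyMoment (wordTrace d w) ^ k ≤
      (∑ i ∈ Finset.range n, (∑ a ∈ words A (i + 1), polyMoment (wordTrace d a) ^ k) *
        (∑ b ∈ words A (n - 1 - i), polyMoment (wordTrace d b) ^ k)) / (d : ℝ) ^ k +
      (Fintype.card A / (d : ℝ) ^ k + ((n : ℝ) + 1) ^ 3 / d) *
        ∑ w ∈ words A n, polyMoment (wordTrace d w) ^ k := by
  have hd0 : (0 : ℝ) < d := by exact_mod_cast hd
  have hnn : ∀ w : List A, 0 ≤ polyMoment (wordTrace d w) ^ k :=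
    fun w => pow_nonneg (polyMoment_nonneg _) k
  set S := ∑ w ∈ words A n, polyMoment (wordTrace d w) ^ k with hS
  have hS0 : 0 ≤ S := Finset.sum_nonneg fun _ _ => hnn _
  let F : List A → List A → ℝ := fun a b =>
    (polyMoment (wordTrace d a) ^ k * polyMoment (wordTrace d b) ^ k) / (d : ℝ) ^ k +
      (if a.Disjoint b then 0 else polyMoment (wordTrace d a * wordTrace d b) ^ k) / d
  have hF : ∀ a b, 0 ≤ F a b := by
    intro a b
    have h2 : 0 ≤ (if a.Disjoint b then 0 else
        polyMoment (wordTrace d a * wordTrace d b) ^ k : ℝ) := by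
      split_ifs
      · exact le_rfl
      · exact pow_nonneg (polyMoment_nonneg _) k
    have h3 := mul_nonneg (hnn a) (hnn b)
    positivity
  -- At most `n` letters occur in `w`; every letter is allotted the fresh-letter contribution as an
  -- upper bound.
  have hfirst : ∑ c : A, ∑ w ∈ words A n, (if c ∈ w then polyMoment (wordTrace d w) ^ k / d
      else polyMoment (wordTrace d w) ^ k / (d : ℝ) ^ k) ≤
      (Fintype.card A / (d : ℝ) ^ k + n / d) * S := by
    rw [Finset.sum_comm, hS, Finset.mul_sum]
    refine Finset.sum_le_sum fun w hw => ?_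
    have hL := hnn w
    set L := polyMoment (wordTrace d w) ^ k
    have h1 : ∀ c : A, (if c ∈ w then L / d else L / (d : ℝ) ^ k) ≤
        L / (d : ℝ) ^ k + if c ∈ w.toFinset then L / d else 0 := by
      intro c
      simp only [List.mem_toFinset]
      have : 0 ≤ L / (d : ℝ) ^ k := by positivity
      split_ifs <;> linarith
    refine (Finset.sum_le_sum fun c _ => h1 c).trans ?_
    rw [Finset.sum_add_distrib, ← Finset.sum_filter, Finset.sum_const, Finset.sum_const,
      nsmul_eq_mul, nsmul_eq_mul, Finset.filter_mem_eq_inter, Finset.univ_inter, Finset.card_univ]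
    have h2 : (w.toFinset.card : ℝ) ≤ n := by
      exact_mod_cast (mem_words.1 hw) ▸ w.toFinset_card_le
    have h3 : (w.toFinset.card : ℝ) * (L / d) ≤ n * (L / d) := by gcongr
    calc _ ≤ (Fintype.card A : ℝ) * (L / (d : ℝ) ^ k) + n * (L / d) := by linarith
      _ = _ := by ring
  have hsecond : ∀ i ∈ Finset.range n,
      ∑ a ∈ words A (i + 1), ∑ b ∈ words A (n - 1 - i), F a b ≤
      ((∑ a ∈ words A (i + 1), polyMoment (wordTrace d a) ^ k) *
        (∑ b ∈ words A (n - 1 - i), polyMoment (wordTrace d b) ^ k)) / (d : ℝ) ^ k +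
        n ^ 2 / d * S := by
    intro i hi
    rw [Finset.mem_range] at hi
    simp only [F, Finset.sum_add_distrib, ← Finset.sum_div]
    rw [Finset.sum_mul_sum]
    refine add_le_add le_rfl ?_
    have h := sum_words_not_disjoint_le (A := A) (d := d) k (i + 1) (n - 1 - i)
    rw [show i + 1 + (n - 1 - i) = n by lia, ← hS] at h
    have h4 : ((i + 1 : ℕ) : ℝ) * ((n - 1 - i : ℕ) : ℝ) ≤ (n : ℝ) ^ 2 := by
      rw [pow_two]
      gcongr <;> lia
    rw [div_mul_eq_mul_div]
    gcongr
    exact h.trans (by gcongr)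
  calc ∑ w ∈ words A (n + 1), polyMoment (wordTrace d w) ^ k
      = ∑ c : A, ∑ w ∈ words A n, polyMoment (wordTrace d (c :: w)) ^ k := sum_words_succ _ _
    _ ≤ ∑ c : A, ∑ w ∈ words A n, ((if c ∈ w then polyMoment (wordTrace d w) ^ k / d
          else polyMoment (wordTrace d w) ^ k / (d : ℝ) ^ k) + ∑ i ∈ Finset.range n,
            if w[i]? = some c then F (c :: w.take i) (w.drop (i + 1)) else 0) := by
        refine Finset.sum_le_sum fun c _ => Finset.sum_le_sum fun w hw => ?_
        have h := polyMoment_wordTrace_cons_pow_le hd hk c w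
        rw [mem_words.1 hw] at h
        exact h
    _ ≤ (Fintype.card A / (d : ℝ) ^ k + n / d) * S + ∑ i ∈ Finset.range n,
          (((∑ a ∈ words A (i + 1), polyMoment (wordTrace d a) ^ k) *
            (∑ b ∈ words A (n - 1 - i), polyMoment (wordTrace d b) ^ k)) / (d : ℝ) ^ k +
            n ^ 2 / d * S) := by
        simp only [Finset.sum_add_distrib (s := words A n), Finset.sum_add_distrib
          (s := (Finset.univ : Finset A))]
        refine add_le_add hfirst ?_
        rw [Finset.sum_congr rfl fun c _ => Finset.sum_comm, Finset.sum_comm]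
        exact Finset.sum_le_sum fun i hi =>
          (sum_words_cut_le n i (Finset.mem_range.1 hi) F hF).trans (hsecond i hi)
    _ ≤ _ := by
        rw [Finset.sum_add_distrib, ← Finset.sum_div, Finset.sum_const, Finset.card_range,
          nsmul_eq_mul]
        -- The `n` comes from repeated first letters, the `n ^ 3` from `n` cuts with at most `n ^ 2`
        -- mergers each.
        have h5 : ((n : ℝ) + n ^ 3) / d * S ≤ ((n : ℝ) + 1) ^ 3 / d * S := by
          have hn : (0 : ℝ) ≤ n := n.cast_nonneg
          gcongr
          nlinarith
        have h6 : ((n : ℝ) + n ^ 3) / d * S = n / d * S + n * (n ^ 2 / d * S) := by ring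
        rw [add_mul, add_mul]
        linarith

end

/-! ### Bounds for the moments -/

lemma normMoment_nonneg {p d k : ℕ} (hd : 1 ≤ d) (m : ℕ) : 0 ≤ normMoment p d k m := by
  rw [normMoment_eq hd]
  exact div_nonneg (Finset.sum_nonneg fun _ _ => pow_nonneg (polyMoment_nonneg _) k)
    (by positivity)

lemma normMoment_zero {p d k : ℕ} (hd : 1 ≤ d) : normMoment p d k 0 = 1 := by
  have hd0 : (d : ℝ) ≠ 0 := by exact_mod_cast (by lia : d ≠ 0)
  rw [normMoment_eq hd, words_zero, Finset.sum_singleton, polyMoment_wordTrace_nil,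
    div_self (pow_ne_zero k hd0)]

/-- The recursion for the moments, with an error of order `1 / d`. -/
lemma normMoment_succ_le {p d k : ℕ} (hd : 1 ≤ d) (hk : 1 ≤ k) (n : ℕ) :
    normMoment p d k (n + 1) ≤
      ∑ l ∈ Finset.range n, normMoment p d k l * normMoment p d k (n - l) +
        ((p : ℝ) / (d : ℝ) ^ k + ((n : ℝ) + 1) ^ 3 / d) * normMoment p d k n := by
  have hd0 : (0 : ℝ) < (d : ℝ) ^ k := pow_pos (by exact_mod_cast hd) k
  have h := sum_words_polyMoment_pow_le (A := Fin p) hd hk n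
  rw [← Finset.sum_range_reflect]
  simp only [normMoment_eq hd]
  rw [Fintype.card_fin] at h
  refine (div_le_div_of_nonneg_right h hd0.le).trans (le_of_eq ?_)
  rw [add_div, mul_div_assoc]
  congr 1
  rw [div_div, Finset.sum_div]
  refine Finset.sum_congr rfl fun i hi => ?_
  rw [Finset.mem_range] at hi
  rw [show n - (n - 1 - i) = i + 1 by lia, div_mul_div_comm, mul_comm]

lemma convSeq_nonneg {x : ℝ} (hx : 0 ≤ x) (n : ℕ) : 0 ≤ convSeq x n := by
  rcases n with _ | n
  · rw [convSeq_zero]; exact zero_le_one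
  · rw [convSeq_eq_narayanaPoly]
    exact Finset.sum_nonneg fun l _ => mul_nonneg (narayana_nonneg _ _) (pow_nonneg hx l)

/-- Fixing `m` makes the error uniform in `n ≤ m`, so one parameter serves the whole induction. -/
lemma normMoment_le_convSeq {p d k : ℕ} (hd : 1 ≤ d) (hk : 1 ≤ k) (m : ℕ) (n : ℕ) (hn : n ≤ m) :
    normMoment p d k n ≤ convSeq ((p : ℝ) / (d : ℝ) ^ k + (m : ℝ) ^ 3 / d) n := by
  have hx : 0 ≤ (p : ℝ) / (d : ℝ) ^ k + (m : ℝ) ^ 3 / d := by positivity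
  induction n using Nat.strong_induction_on with
  | _ n ih =>
    rcases n with _ | n
    · rw [normMoment_zero hd, convSeq_zero]
    · refine (normMoment_succ_le hd hk n).trans ?_
      rw [convSeq_succ']
      refine add_le_add (Finset.sum_le_sum fun l hl => ?_) ?_
      · rw [Finset.mem_range] at hl
        exact mul_le_mul (ih l (by lia) (by lia)) (ih (n - l) (by lia) (by lia))
          (normMoment_nonneg hd _) (convSeq_nonneg hx _)
      · refine mul_le_mul ?_ (ih n (by lia) (by lia)) (normMoment_nonneg hd _) hx
        have h1 : (n : ℝ) + 1 ≤ m := by exact_mod_cast hn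
        gcongr

/-- The homogenised Narayana polynomial. -/
lemma pow_mul_narayanaPoly_div {a : ℝ} (ha : a ≠ 0) (m : ℕ) (y : ℝ) :
    a ^ m * narayanaPoly m (y / a) =
      ∑ l ∈ Finset.Icc 1 m, narayana m l * (a ^ (m - l) * y ^ l) := by
  rw [narayanaPoly, Finset.mul_sum]
  refine Finset.sum_congr rfl fun l hl => ?_
  rw [← Nat.sub_add_cancel (Finset.mem_Icc.1 hl).2, pow_add, div_pow]
  simp only [Nat.add_sub_cancel]
  field_simp

/-- Homogenizing puts nonnegative powers `a ^ (m - l)` on nonnegative coefficients. -/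
lemma pow_mul_narayanaPoly_div_le {a b y : ℝ} (ha : 0 < a) (hab : a ≤ b) (hy : 0 ≤ y) (m : ℕ) :
    a ^ m * narayanaPoly m (y / a) ≤ b ^ m * narayanaPoly m (y / b) := by
  rw [pow_mul_narayanaPoly_div ha.ne', pow_mul_narayanaPoly_div (ha.trans_le hab).ne']
  refine Finset.sum_le_sum fun l _ => mul_le_mul_of_nonneg_left ?_ (narayana_nonneg m l)
  gcongr

lemma narayanaPoly_mono {x y : ℝ} (hx : 0 ≤ x) (hxy : x ≤ y) (m : ℕ) :
    narayanaPoly m x ≤ narayanaPoly m y :=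
  Finset.sum_le_sum fun l _ => mul_le_mul_of_nonneg_left (by gcongr) (narayana_nonneg m l)

lemma narayanaPoly_nonneg {x : ℝ} (hx : 0 ≤ x) (m : ℕ) : 0 ≤ narayanaPoly m x :=
  Finset.sum_nonneg fun l _ => mul_nonneg (narayana_nonneg m l) (pow_nonneg hx l)

theorem mainTheorem9 (p d k m : ℕ) (hd : 1 ≤ d) (hk : 1 ≤ k) (hm : 1 ≤ m)
    (x γ xt : ℝ)
    (hx : x = (p : ℝ) / (d : ℝ) ^ k)
    (hγ : γ = (m : ℝ) ^ k / (d : ℝ) ^ (1 / (k : ℝ)))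
    (hxt : xt = (p : ℝ) / (d : ℝ) ^ k + 3 * (m : ℝ) ^ (k + 3) / (d : ℝ) ^ (1 / (k : ℝ))) :
    -- the recursion, in its two forms
    (normMoment p d k m ≤
        (1 + γ) * ∑ l ∈ Finset.range (m - 1),
            normMoment p d k l * normMoment p d k (m - l - 1)
          + xt * normMoment p d k (m - 1)) ∧
    ((1 + γ) * ∑ l ∈ Finset.range (m - 1),
            normMoment p d k l * normMoment p d k (m - l - 1)
          + xt * normMoment p d k (m - 1) =
        (1 + γ) * ∑ l ∈ Finset.range m,
            normMoment p d k l * normMoment p d k (m - l - 1)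
          + (xt - (1 + γ)) * normMoment p d k (m - 1)) ∧
    -- the bounds that follow from it
    (normMoment p d k m ≤ (1 + γ) ^ m * narayanaPoly m (xt / (1 + γ))) ∧
    (1 ≤ p →
      (x ≤ 3 * (m : ℝ) ^ 3 →
        (1 + γ) ^ m * narayanaPoly m (xt / (1 + γ)) ≤ (xt / x) ^ m * narayanaPoly m x) ∧
      normMoment p d k m ≤ (xt / x) ^ m * narayanaPoly m x ∧
      (xt / x) ^ m * narayanaPoly m x ≤
        Real.exp (3 * (m : ℝ) ^ (k + 4) / (x * (d : ℝ) ^ (1 / (k : ℝ)))) * narayanaPoly m x ∧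
      normMoment p d k m ≤
        Real.exp (3 * (m : ℝ) ^ (k + 4) / (x * (d : ℝ) ^ (1 / (k : ℝ)))) *
          narayanaPoly m x) := by

  have hd0 : (0 : ℝ) < d := by exact_mod_cast hd
  have hd1 : (1 : ℝ) ≤ d := by exact_mod_cast hd
  have hm0 : (0 : ℝ) < m := by exact_mod_cast hm
  have hm1 : (1 : ℝ) ≤ m := by exact_mod_cast hm
  have hx0 : 0 ≤ x := by rw [hx]; positivity
  set δ : ℝ := (d : ℝ) ^ (1 / (k : ℝ)) with hδ
  have hδ0 : 0 < δ := Real.rpow_pos_of_pos hd0 _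
  have hδd : δ ≤ d := by
    rw [hδ]
    conv_rhs => rw [← Real.rpow_one (d : ℝ)]
    refine Real.rpow_le_rpow_of_exponent_le hd1 ?_
    rw [div_le_one (by exact_mod_cast hk)]
    exact_mod_cast hk
  have hγ0 : 0 ≤ γ := by rw [hγ]; positivity
  have hxtγ : xt = x + 3 * (m : ℝ) ^ 3 * γ := by
    rw [hxt, hx, hγ, pow_add]; ring
  -- The proved error is smaller than the stated one, since `d ^ (1 / k) ≤ d` and `m ^ k ≥ 1`.
  have herr : (m : ℝ) ^ 3 / d ≤ 3 * (m : ℝ) ^ 3 * γ := by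
    rw [hγ, mul_div_assoc', div_le_div_iff₀ hd0 hδ0]
    have h1 : (1 : ℝ) ≤ (m : ℝ) ^ k := one_le_pow₀ hm1
    have h3 : 0 < (m : ℝ) ^ 3 := by positivity
    calc (m : ℝ) ^ 3 * δ ≤ (m : ℝ) ^ 3 * d := by gcongr
      _ = (m : ℝ) ^ 3 * 1 * d := by ring
      _ ≤ (3 * (m : ℝ) ^ 3) * (m : ℝ) ^ k * d := by gcongr; linarith
  have hyxt : x + (m : ℝ) ^ 3 / d ≤ xt := by rw [hxtγ]; linarith
  have hy0 : 0 ≤ x + (m : ℝ) ^ 3 / d := by positivity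
  have hxt0 : 0 ≤ xt := hy0.trans hyxt
  have hbound : normMoment p d k m ≤ narayanaPoly m xt := by
    have h1 := normMoment_le_convSeq (p := p) hd hk m m le_rfl
    rw [← hx] at h1
    obtain ⟨n, rfl⟩ : ∃ n, m = n + 1 := ⟨m - 1, by lia⟩
    rw [convSeq_eq_narayanaPoly] at h1
    exact h1.trans (narayanaPoly_mono hy0 hyxt _)
  have hhom : narayanaPoly m xt ≤ (1 + γ) ^ m * narayanaPoly m (xt / (1 + γ)) := by
    have h1 := pow_mul_narayanaPoly_div_le one_pos (by linarith : (1 : ℝ) ≤ 1 + γ) hxt0 m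
    rwa [one_pow, one_mul, div_one] at h1
  refine ⟨?_, ?_, hbound.trans hhom, fun hp => ?_⟩
  · have h1 := normMoment_succ_le (p := p) hd hk (m - 1)
    rw [Nat.sub_add_cancel hm, Nat.cast_sub hm, Nat.cast_one, sub_add_cancel, ← hx] at h1
    refine h1.trans (add_le_add ?_ (mul_le_mul_of_nonneg_right hyxt (normMoment_nonneg hd _)))
    have h2 : ∀ l, m - 1 - l = m - l - 1 := fun l => by lia
    simp only [h2]
    exact le_mul_of_one_le_left (Finset.sum_nonneg fun l _ =>
      mul_nonneg (normMoment_nonneg hd _) (normMoment_nonneg hd _)) (by linarith)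
  · have h1 : Finset.range m = Finset.range (m - 1 + 1) := by rw [Nat.sub_add_cancel hm]
    rw [h1, Finset.sum_range_succ, show m - (m - 1) - 1 = 0 by lia, normMoment_zero hd]
    ring
  · have hxpos : 0 < x := by
      have : (0 : ℝ) < p := by exact_mod_cast hp
      rw [hx]; positivity
    have hβ := narayanaPoly_nonneg hx0 m
    -- Homogenizing with `a = xt / x` brings the argument back to `x`.
    have hxxt : xt / (xt / x) = x := by
      have : 0 < xt := hxpos.trans_le (by
        rw [hxtγ]; linarith [show 0 ≤ 3 * (m : ℝ) ^ 3 * γ by positivity])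
      field_simp
    have hratio : xt / x = 1 + 3 * (m : ℝ) ^ 3 * γ / x := by
      rw [hxtγ]; field_simp
    have h1ratio : 1 ≤ xt / x := by
      rw [hratio]; linarith [show 0 ≤ 3 * (m : ℝ) ^ 3 * γ / x by positivity]
    have hb2 : normMoment p d k m ≤ (xt / x) ^ m * narayanaPoly m x := by
      have h1 := pow_mul_narayanaPoly_div_le one_pos h1ratio hxt0 m
      rw [one_pow, one_mul, div_one, hxxt] at h1
      exact hbound.trans h1
    have hexp : (xt / x) ^ m * narayanaPoly m x ≤
        Real.exp (3 * (m : ℝ) ^ (k + 4) / (x * δ)) * narayanaPoly m x := by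
      refine mul_le_mul_of_nonneg_right ?_ hβ
      have h1 : xt / x ≤ Real.exp (3 * (m : ℝ) ^ 3 * γ / x) := by
        rw [hratio, add_comm]; exact Real.add_one_le_exp _
      refine (pow_le_pow_left₀ (zero_le_one.trans h1ratio) h1 m).trans (le_of_eq ?_)
      rw [← Real.exp_nat_mul, hγ]
      congr 1
      field_simp
      ring
    refine ⟨fun hx3 => ?_, hb2, hexp, hb2.trans hexp⟩
    -- As `xt / x = 1 + 3 m^3 γ / x`, this is where `x ≤ 3 m^3` enters.
    have h1 : 1 + γ ≤ xt / x := by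
      rw [hratio]
      gcongr
      rw [le_div_iff₀ hxpos, mul_comm]
      gcongr
    have h2 := pow_mul_narayanaPoly_div_le (by linarith : 0 < 1 + γ) h1 hxt0 m
    rwa [hxxt] at h2
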